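/- Fix an integer $k\ge 3$. A $k$-graph on $n$ vertices is a set $E(\mathcal H)$ of $k$-element subsets of the vertex set $\{0,\dots,n-1\}$; a legal $2$-coloring of $\mathcal H$ is a map from the vertices to $\{0,1\}$ under which no edge is monochromatic, and $\mathcal H$ is $2$-colorable if it has one. Algorithms are randomized programs for a word RAM whose words have $O(\log n)$ bits. In one step such a program can perform a basic operation on words (constants, addition, subtraction, comparison, direct or indirect memory access), draw a uniformly random vertex, or ask an edge query "is $\{v_1,\dots,v_k\}$ an edge of $\mathcal H$?". A coloring oracle is a single such program $A$ (the same for all $n$) that, given $n$ and a vertex $u$ and with edge-query access to a $2$-colorable $k$-graph $\mathcal H$ on $n$ vertices, always halts and returns a color in $\{0,1\}$ for $u$, such that (i) for every $2$-colorable $\mathcal H$ and every sequence of queried vertices $u_1,u_2,\dots$, whatever the random choices made in the successive calls, all the answers agree with a single legal $2$-coloring of $\mathcal H$; and (ii) only $o(n)$ bits of memory are kept between successive calls. Let $T_A(\mathcal H,u)$ be the expected number of steps of a call of $A$ on the vertex $u$ of $\mathcal H$ (the supremum over the contents of the kept memory, if there is any), let $T_A(\mathcal H)=\max_u T_A(\mathcal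 H,u)$, and let $T_A(n)$ be the average of $T_A(\mathcal H)$ over all $2$-colorable $k$-graphs $\mathcal H$ on $n$ labelled vertices. Theorem. For every $k\ge 3$ there are a coloring oracle $A$ and a constant $C=C(k)$ such that $T_A(n)\le C$ for every $n$; moreover $A$ keeps no memory at all between successive calls. -/

import Mathlib

open scoped ENNReal NNReal

namespace ColoringOracle

/-! ### Uniform hypergraphs and legal 2-colorings -/

/-- A `k`-graph (`k`-uniform hypergraph) on the vertex set `{0, …, n - 1}`:
a set of edges, each of which is a set of exactly `k` vertices. -/
abbrev KGraph (k n : ℕ) : Type :=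
  {E : Finset (Finset (Fin n)) // ∀ e ∈ E, e.card = k}

variable {k n : ℕ}

/-- `c` is a legal 2-coloring of `H`: every edge contains two vertices of different colors. -/
def KGraph.IsLegalColoring (H : KGraph k n) (c : Fin n → Fin 2) : Prop :=
  ∀ e ∈ H.1, ∃ v ∈ e, ∃ w ∈ e, c v ≠ c w

/-- `H` is 2-colorable. -/
def KGraph.TwoColorable (H : KGraph k n) : Prop :=
  ∃ c : Fin n → Fin 2, H.IsLegalColoring c

open scoped Classical in
/-- The set of all 2-colorable `k`-graphs on `n` (labelled) vertices. -/
noncomputable def twoColorableGraphs (k n : ℕ) : Finset (KGraph k n) :=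
  Finset.univ.filter fun H => H.TwoColorable

/-! ### The machine model: a randomized word RAM with edge queries

The memory is a sequence of cells indexed by `ℕ`, each holding a natural number. All arithmetic is
done modulo the word bound `W`, so that every cell holds a word below `W`. Direct addresses are
constants of the program, indirect addresses are words. -/

/-- The instructions of the machine; the arguments `d a b …` are constant addresses of cells. -/
inductive Instr (k : ℕ) : Type
  /-- do nothing -/
  | skip : Instr k
  /-- `mem[d] := v` for a constant `v` of the program -/
  | const (d v : ℕ) : Instr k
  /-- `mem[d] := mem[a] + mem[b]`, modulo the word bound -/
  | add (d a b : ℕ) : Instr k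
  /-- `mem[d] := mem[a] - mem[b]`, and `0` if this is negative -/
  | sub (d a b : ℕ) : Instr k
  /-- indirect read: `mem[d] := mem[mem[a]]` -/
  | load (d a : ℕ) : Instr k
  /-- indirect write: `mem[mem[a]] := mem[b]` -/
  | store (a b : ℕ) : Instr k
  /-- `mem[d] :=` a fresh uniformly random vertex -/
  | rand (d : ℕ) : Instr k
  /-- `mem[d] := 1` if `mem[v 0], …, mem[v (k-1)]` form an edge of the hypergraph,
  and `mem[d] := 0` otherwise -/
  | query (d : ℕ) (v : Fin k → ℕ) : Instr k

/-- Structured programs over these instructions, with tests of the form `mem[a] < mem[b]`. -/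
inductive Prog (k : ℕ) : Type
  | instr (i : Instr k) : Prog k
  | seq (P Q : Prog k) : Prog k
  /-- if `mem[a] < mem[b]` then `P` else `Q` -/
  | ite (a b : ℕ) (P Q : Prog k) : Prog k
  /-- while `mem[a] < mem[b]` do `P` -/
  | loop (a b : ℕ) (P : Prog k) : Prog k

/-- The state of a run: the memory, and the number of random vertices drawn so far. -/
structure State : Type where
  mem : ℕ → ℕ
  drawn : ℕ

/-- The `k`-tuple of numbers `x` is a tuple of vertices that form an edge of `H`. (A tuple
with a repeated entry, or with an entry that is not a vertex, does not.) -/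
def KGraph.IsEdgeTuple (H : KGraph k n) (x : Fin k → ℕ) : Prop :=
  ∃ w : Fin k → Fin n, (∀ i, x i = (w i : ℕ)) ∧ Finset.univ.image w ∈ H.1

open scoped Classical in
/-- The effect of one instruction on the hypergraph `H` with word bound `W`, when `ω` is the
sequence of random vertices available to the run. -/
noncomputable def Instr.step (H : KGraph k n) (W : ℕ) (ω : ℕ → Fin n) (s : State) :
    Instr k → State
  | .skip => s
  | .const d v => { s with mem := Function.update s.mem d (v % W) }
  | .add d a b => { s with mem := Function.update s.mem d ((s.mem a + s.mem b) % W) }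
  | .sub d a b => { s with mem := Function.update s.mem d (s.mem a - s.mem b) }
  | .load d a => { s with mem := Function.update s.mem d (s.mem (s.mem a)) }
  | .store a b => { s with mem := Function.update s.mem (s.mem a) (s.mem b) }
  | .rand d => ⟨Function.update s.mem d (ω s.drawn), s.drawn + 1⟩
  | .query d v =>
    let answer : ℕ := if H.IsEdgeTuple (fun i => s.mem (v i)) then 1 else 0
    { s with mem := Function.update s.mem d answer }

/-- `Exec H W ω P s s' t`: the program `P`, started in state `s`, halts in state `s'` after exactly
`t` steps. Every executed instruction and every evaluated test is one step. -/
inductive Exec (H : KGraph k n) (W : ℕ) (ω : ℕ → Fin n) :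
    Prog k → State → State → ℕ → Prop
  | instr (i : Instr k) (s : State) :
      Exec H W ω (.instr i) s (i.step H W ω s) 1
  | seq {P Q : Prog k} {s s₁ s₂ : State} {t₁ t₂ : ℕ} :
      Exec H W ω P s s₁ t₁ → Exec H W ω Q s₁ s₂ t₂ →
      Exec H W ω (.seq P Q) s s₂ (t₁ + t₂)
  | ite_true {a b : ℕ} {P Q : Prog k} {s s' : State} {t : ℕ} :
      s.mem a < s.mem b → Exec H W ω P s s' t →
      Exec H W ω (.ite a b P Q) s s' (1 + t)
  | ite_false {a b : ℕ} {P Q : Prog k} {s s' : State} {t : ℕ} :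
      ¬ s.mem a < s.mem b → Exec H W ω Q s s' t →
      Exec H W ω (.ite a b P Q) s s' (1 + t)
  | loop_true {a b : ℕ} {P : Prog k} {s s₁ s₂ : State} {t₁ t₂ : ℕ} :
      s.mem a < s.mem b → Exec H W ω P s s₁ t₁ → Exec H W ω (.loop a b P) s₁ s₂ t₂ →
      Exec H W ω (.loop a b P) s s₂ (1 + t₁ + t₂)
  | loop_false {a b : ℕ} {P : Prog k} {s : State} :
      ¬ s.mem a < s.mem b →
      Exec H W ω (.loop a b P) s s 1

/-! ### Coloring oracles -/

/-- A randomized algorithm for `k`-graphs of every size: one program, the exponent that fixes the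
word length, and the number of memory cells whose contents are kept between successive calls
(as a function of the number of vertices). -/
structure Algorithm (k : ℕ) : Type where
  prog : Prog k
  wordExp : ℕ
  kept : ℕ → ℕ

namespace Algorithm

variable (A : Algorithm k)

/-- On `n` vertices, words are numbers below `(n + 2) ^ (wordExp + 1)`, that is, they have
`O(log n)` bits. -/
def wordBound (n : ℕ) : ℕ := (n + 2) ^ (A.wordExp + 1)

/-- The memory at the start of a call on vertex `u`, when `m` is the memory at the end of the
previous call: cell `0` holds `u`, cell `1` holds `n`, the next `A.kept n` cells have kept their
contents, and all other cells are erased. -/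
def startMem (m : ℕ → ℕ) (u : Fin n) : ℕ → ℕ := fun j =>
  if j = 0 then (u : ℕ) else if j = 1 then n else if j < 2 + A.kept n then m j else 0

/-- A call on vertex `u` of `H` that uses the random vertices `ω` and follows a call that ended with
memory `m`: it takes `t` steps and ends with memory `m'`. The color returned is `m' 0`. -/
def Call (H : KGraph k n) (ω : ℕ → Fin n) (m : ℕ → ℕ) (u : Fin n) (m' : ℕ → ℕ) (t : ℕ) : Prop :=
  ∃ r : ℕ, Exec H (A.wordBound n) ω A.prog ⟨A.startMem m u, 0⟩ ⟨m', r⟩ t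

/-- `A` is a coloring oracle. (i) On every 2-colorable `H`, for every sequence of queried vertices
`u 0, u 1, …` and whatever the random choices `ω i` made in the `i`-th call, every call halts, and
the colors returned are consistent with a single legal 2-coloring of `H`. (The memory is all `0`
before the first call, and `m (i + 1)` is the memory at the end of the `i`-th call.)
(ii) Only `o(n)` bits are kept between calls. -/
def IsColoringOracle : Prop :=
  (∀ (n : ℕ) (H : KGraph k n), H.TwoColorable →
    ∀ (u : ℕ → Fin n) (ω : ℕ → ℕ → Fin n),
      ∃ m : ℕ → ℕ → ℕ, m 0 = (fun _ => 0) ∧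
        (∀ i, ∃ t, A.Call H (ω i) (m i) (u i) (m (i + 1)) t) ∧
        ∃ c : Fin n → Fin 2, H.IsLegalColoring c ∧ ∀ i, m (i + 1) 0 = (c (u i) : ℕ)) ∧
  (fun n => (A.kept n : ℝ) * Real.logb 2 (A.wordBound n)) =o[Filter.atTop] (fun n => (n : ℝ))

/-- `A` keeps no memory between successive calls. -/
def Memoryless : Prop := ∀ n, A.kept n = 0

/-- The number of steps of a call (`∞` if it does not halt). -/
noncomputable def callTime (H : KGraph k n) (m : ℕ → ℕ) (u : Fin n) (ω : ℕ → Fin n) : ℝ≥0∞ :=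
  sInf {x : ℝ≥0∞ | ∃ (m' : ℕ → ℕ) (t : ℕ), A.Call H ω m u m' t ∧ x = t}

/-- The law of a sequence of independent uniformly random vertices. -/
noncomputable def coins (n : ℕ) : MeasureTheory.Measure (ℕ → Fin n) :=
  MeasureTheory.Measure.infinitePi fun _ : ℕ => ProbabilityTheory.uniformOn (Set.univ : Set (Fin n))

/-- `T_A(H, u)`: the expected number of steps of a call on the vertex `u` of `H`, whatever has been
kept from the previous call. -/
noncomputable def expectedTime (H : KGraph k n) (u : Fin n) : ℝ≥0∞ :=
  ⨆ m : ℕ → ℕ, ∫⁻ ω, A.callTime H m u ω ∂(coins n)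

/-- `T_A(H)`: the worst case of `T_A(H, u)` over all vertices `u` of `H`. -/
noncomputable def worstTime (H : KGraph k n) : ℝ≥0∞ :=
  ⨆ u : Fin n, A.expectedTime H u

/-- `T_A(n)`: the average of `T_A(H)` over all 2-colorable `k`-graphs `H` on `n` vertices. -/
noncomputable def averageTime (n : ℕ) : ℝ≥0∞ :=
  (∑ H ∈ twoColorableGraphs k n, A.worstTime H) / (twoColorableGraphs k n).card

end Algorithm

end ColoringOracle

/-! The oracle compares the queried vertex `u` with the fixed reference vertex `v = n - 1`. It
always answers with one particular legal coloring, `canonColoring H v`: the first legal coloring in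
binary order, normalized so that `v` gets color `0`. This depends on `H` alone, so no memory is
needed for consistency.

A fast answer comes from forcing. Take `2(k-1)` sample points and a vertex `w`, and suppose that all
`k`-subsets of these `2k-1` points are edges except `{w} ∪ Y`, where `Y` is half of the sample. In
every legal coloring, `Y` is then exactly the set of sample points colored like `w`
(`Cert.color_eq_iff`). Two such gadgets on the same sample, one for `u` and one for `v`, determine
the relative color of `u` and `v`. The oracle tests up to `K n` random samples and resorts to
exhaustive search only if all of them fail. If for every `u` at least a fraction `η` of the samples
decide, the expected number of trials is at most `1/η`. All `K n` trials fail with probability at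
most `(1-η)^(Kn) ≤ exp(-2n)`, which cancels the `O(exp(2n))` cost of the search.

It remains to show that the other, atypical, hypergraphs are so rare that even `exp(2n)` steps on
each do not affect the average. Fix a coloring `c`, with which `H` is an arbitrary set of
bichromatic `k`-sets, and take a union bound over the `2^n` choices of `c`.

If both color classes are large, choose `2(k-1)` disjoint monochromatic groups of `P` vertices, with
`P` a prime of order `n`, and index samples by functions to `ZMod P`. The `P^2` lines `i ↦ a i + b`
give gadgets that are pairwise edge-disjoint: a common edge would contain at least `k-1 ≥ 2` common
sample points, and two points determine a line. Too few of these gadgets are present with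
probability `exp(-Ω(n^2))` (`card_filter_few_le`). Averaging over all translates of the family of
lines extends this to all transversal samples (`Groups.card_few_gadgets_le`).

If one class has at least `3n/4` vertices, `c` admits at least `n^2/48` fewer bichromatic `k`-sets
than a balanced coloring, so its hypergraphs are an `exp(-Ω(n^2))` fraction of all 2-colorable ones
(`two_pow_mul_le_of_unbalanced`).

Altogether the atypical fraction is at most `2^n n^(2k-1) exp(-κ n^2)`, and its product with
`exp(2n)` is bounded. -/

namespace ColoringOracle

variable {k n : ℕ}

/-! ### A program logic with time bounds -/

/-- Started in state `s`, the program `P` halts after at most `T` steps in a state satisfying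
`Q`. -/
def Reach (H : KGraph k n) (W : ℕ) (ω : ℕ → Fin n) (P : Prog k) (s : State) (T : ℕ)
    (Q : State → Prop) : Prop :=
  ∃ s' t, Exec H W ω P s s' t ∧ t ≤ T ∧ Q s'

section Rules

variable {H : KGraph k n} {W : ℕ} {ω : ℕ → Fin n} {P P' : Prog k} {s : State}
  {T T' : ℕ} {Q R : State → Prop}

theorem Reach.mono (h : Reach H W ω P s T Q) (hT : T ≤ T') (hQ : ∀ s, Q s → R s) :
    Reach H W ω P s T' R := by
  obtain ⟨s', t, he, ht, hq⟩ := h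
  exact ⟨s', t, he, ht.trans hT, hQ _ hq⟩

theorem Reach.instr {i : Instr k} (h : Q (i.step H W ω s)) :
    Reach H W ω (.instr i) s (T + 1) Q :=
  ⟨_, 1, .instr i s, by omega, h⟩

theorem Reach.seq (h : Reach H W ω P s T fun s' => Reach H W ω P' s' T' Q) :
    Reach H W ω (.seq P P') s (T + T') Q := by
  obtain ⟨s', t, he, ht, s'', t', he', ht', hq⟩ := h
  exact ⟨s'', t + t', .seq he he', by omega, hq⟩

theorem Reach.instr_seq {i : Instr k} (h : Reach H W ω P (i.step H W ω s) T Q) :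
    Reach H W ω (.seq (.instr i) P) s (T + 1) Q := by
  rw [add_comm]
  exact Reach.seq (Reach.instr (T := 0) h)

theorem Reach.ite {a b : ℕ} (h : s.mem a < s.mem b → Reach H W ω P s T Q)
    (h' : ¬ s.mem a < s.mem b → Reach H W ω P' s T Q) :
    Reach H W ω (.ite a b P P') s (T + 1) Q := by
  by_cases hc : s.mem a < s.mem b
  · obtain ⟨s', t, he, ht, hq⟩ := h hc
    exact ⟨s', 1 + t, .ite_true hc he, by omega, hq⟩
  · obtain ⟨s', t, he, ht, hq⟩ := h' hc
    exact ⟨s', 1 + t, .ite_false hc he, by omega, hq⟩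

/-- The exact number `N` of iterations is supplied in advance; an invariant indexed by completed
iterations then gives termination and the time bound together. -/
theorem Reach.loop {a b : ℕ} (N : ℕ) (I : ℕ → State → Prop)
    (hstep : ∀ j s, j < N → I j s → s.mem a < s.mem b ∧ Reach H W ω P s T (I (j + 1)))
    (hend : ∀ s, I N s → ¬ s.mem a < s.mem b) (h0 : I 0 s) :
    Reach H W ω (.loop a b P) s (N * (T + 1) + 1) (I N) := by
  suffices ∀ r j s, j + r = N → I j s →
      Reach H W ω (.loop a b P) s (r * (T + 1) + 1) (I N) from this N 0 s (by omega) h0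
  intro r
  induction r with
  | zero =>
    intro j s hj hI
    obtain rfl : j = N := by omega
    exact ⟨s, 1, .loop_false (hend s hI), by omega, hI⟩
  | succ r ih =>
    intro j s hj hI
    obtain ⟨hlt, s₁, t₁, he₁, ht₁, hI₁⟩ := hstep j s (by omega) hI
    obtain ⟨s₂, t₂, he₂, ht₂, hI₂⟩ := ih (j + 1) s₁ (by omega) hI₁
    refine ⟨s₂, 1 + t₁ + t₂, .loop_true hlt he₁ he₂, ?_, hI₂⟩
    rw [add_mul]
    omega

end Rules

/-! ### Memory layout -/

/-- Address of the first cell of the array that stores a coloring. -/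
def arr (k : ℕ) : ℕ := 20 + 2 * k

/-- The fixed part of the memory: the input, the constants, and an array that holds the binary
expansion of `j`. -/
structure Env (k n u W j : ℕ) (m : ℕ → ℕ) : Prop where
  vertex : m 0 = u
  size : m 1 = n
  ref : m 2 = n - 1
  one : m 3 = 1
  base : m 4 = arr k
  zero : m 5 = 0
  bits : ∀ i, m (arr k + i) = (j.testBit i).toNat
  vertex_lt : u < n
  space : n + arr k < W

/-- Frame rule: the cells from `6` up to `arr k` are scratch. Cell `6` is the illegality flag, `7`
and `8` the trial counter and its limit, `9` to `14` temporaries, `15` the outcome of the trials,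
and the cells from `20` on hold the current tuple or sample. -/
theorem Env.congr {u W j : ℕ} {m m' : ℕ → ℕ} (h : Env k n u W j m)
    (hm : ∀ d, d < 6 ∨ arr k ≤ d → m' d = m d) : Env k n u W j m' where
  vertex := by rw [hm _ (by omega), h.vertex]
  size := by rw [hm _ (by omega), h.size]
  ref := by rw [hm _ (by omega), h.ref]
  one := by rw [hm _ (by omega), h.one]
  base := by rw [hm _ (by omega), h.base]
  zero := by rw [hm _ (by omega), h.zero]
  bits i := by rw [hm _ (by omega), h.bits]
  vertex_lt := h.vertex_lt
  space := h.space

/-! ### Checking a coloring against all edges -/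

/-- Cells `13` and `14` record whether colors `0` and `1` occur among the first `t` entries of the
current tuple. -/
def scanColors (k : ℕ) : ℕ → Prog k
  | 0 => .instr .skip
  | t + 1 => .seq (scanColors k t) (.seq (.instr (.add 11 4 (20 + t)))
      (.seq (.instr (.load 12 11)) (.ite 5 12 (.instr (.const 14 1)) (.instr (.const 13 1)))))

open scoped Classical in
theorem reach_scanColors {H : KGraph k n} {W : ℕ} {ω : ℕ → Fin n} {u j : ℕ} {s : State}
    (hE : Env k n u W j s.mem) (h13 : s.mem 13 = 0) (h14 : s.mem 14 = 0) (t : ℕ) (htk : t ≤ k)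
    (hy : ∀ i < t, s.mem (20 + i) < n) :
    Reach H W ω (scanColors k t) s (4 * t + 1) fun s' =>
      (∀ d, d < 11 ∨ 14 < d → s'.mem d = s.mem d) ∧
      (s'.mem 13 = if ∃ i < t, j.testBit (s.mem (20 + i)) = false then 1 else 0) ∧
      (s'.mem 14 = if ∃ i < t, j.testBit (s.mem (20 + i)) = true then 1 else 0) := by
  induction t with
  | zero => exact Reach.instr (T := 0) ⟨fun _ _ => rfl, by simpa [Instr.step] using h13,
      by simpa [Instr.step] using h14⟩
  | succ t ih =>
    have := ih (by omega) fun i hi => hy i (by omega)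
    refine Reach.mono (Reach.seq (T' := 4) (this.mono le_rfl ?_)) (by omega) fun _ h => h
    rintro ⟨m, r⟩ ⟨hm, hm13, hm14⟩
    dsimp only at hm hm13 hm14
    have hE' : Env k n u W j m := hE.congr fun d hd => hm d (by unfold arr at hd; omega)
    have hyt : s.mem (20 + t) < n := hy t (by omega)
    have hW := hE.space
    have h1 : 1 % W = 1 := Nat.mod_eq_of_lt (by unfold arr at hW; omega)
    have hadd : (m 4 + m (20 + t)) % W = arr k + s.mem (20 + t) := by
      rw [hE'.base, hm _ (by omega), Nat.mod_eq_of_lt (by omega)]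
    apply Reach.instr_seq
    apply Reach.instr_seq
    have hload : m (arr k + s.mem (20 + t)) = (j.testBit (s.mem (20 + t))).toNat := hE'.bits _
    have hz : m 5 = 0 := hE'.zero
    have harr : 14 < arr k := by unfold arr; omega
    apply Reach.ite
    · intro hlt
      apply Reach.instr
      have hb : j.testBit (s.mem (20 + t)) = true := by
        by_contra hb
        simp only [Bool.not_eq_true] at hb
        simp [Instr.step, hadd, hload, hz, hb, show arr k + s.mem (20 + t) ≠ 11 by omega] at hlt
      refine ⟨fun d hd => ?_, ?_, ?_⟩
      · simp only [Instr.step]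
        rw [Function.update_of_ne (by omega), Function.update_of_ne (by omega),
          Function.update_of_ne (by omega), hm d hd]
      · simp only [Instr.step]
        rw [Function.update_of_ne (by omega), Function.update_of_ne (by omega),
          Function.update_of_ne (by omega), hm13]
        simp only [Order.lt_add_one_iff]
        congr 1
        refine propext ⟨fun ⟨i, hi, h⟩ => ⟨i, hi.le, h⟩, fun ⟨i, hi, h⟩ => ⟨i, ?_, h⟩⟩
        refine lt_of_le_of_ne hi ?_
        rintro rfl
        simp [hb] at h
      · simp only [Instr.step, Function.update_self]
        rw [if_pos ⟨t, by omega, hb⟩, h1]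
    · intro hlt
      apply Reach.instr
      have hb : j.testBit (s.mem (20 + t)) = false := by
        by_contra hb
        simp only [Bool.not_eq_false] at hb
        simp [Instr.step, hadd, hload, hz, hb, show arr k + s.mem (20 + t) ≠ 11 by omega] at hlt
      refine ⟨fun d hd => ?_, ?_, ?_⟩
      · simp only [Instr.step]
        rw [Function.update_of_ne (by omega), Function.update_of_ne (by omega),
          Function.update_of_ne (by omega), hm d hd]
      · simp only [Instr.step, Function.update_self]
        rw [if_pos ⟨t, by omega, hb⟩, h1]
      · simp only [Instr.step]
        rw [Function.update_of_ne (by omega), Function.update_of_ne (by omega),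
          Function.update_of_ne (by omega), hm14]
        simp only [Order.lt_add_one_iff]
        congr 1
        refine propext ⟨fun ⟨i, hi, h⟩ => ⟨i, hi.le, h⟩, fun ⟨i, hi, h⟩ => ⟨i, ?_, h⟩⟩
        refine lt_of_le_of_ne hi ?_
        rintro rfl
        simp [hb] at h

/-- The tuple `y` is an edge that is monochromatic in the coloring by the bits of `j`. -/
def Violates (H : KGraph k n) (j : ℕ) (y : ℕ → ℕ) : Prop :=
  H.IsEdgeTuple (fun i : Fin k => y i) ∧
    ¬ ((∃ i < k, j.testBit (y i) = false) ∧ ∃ i < k, j.testBit (y i) = true)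

/-- Set cell `6` to `1` if the tuple in the cells `20, …` is a monochromatic edge. -/
def checkTuple (k : ℕ) : Prog k :=
  .seq (.instr (.query 10 fun i => 20 + i)) (.seq (.instr (.const 13 0)) (.seq
    (.instr (.const 14 0)) (.seq (scanColors k k) (.seq (.instr (.add 13 13 14))
      (.ite 10 13 (.instr .skip) (.instr (.const 6 1)))))))

theorem Violates.congr {H : KGraph k n} {j : ℕ} {y z : ℕ → ℕ} (h : ∀ i < k, y i = z i) :
    Violates H j y ↔ Violates H j z := by
  unfold Violates
  have h1 : (fun i : Fin k => y i) = fun i : Fin k => z i := funext fun i => h i i.2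
  have h2 : ∀ b, (∃ i < k, j.testBit (y i) = b) ↔ ∃ i < k, j.testBit (z i) = b := fun b =>
    exists_congr fun i => and_congr_right fun hi => by rw [h i hi]
  rw [h1, h2, h2]

theorem reach_checkTuple {H : KGraph k n} {W : ℕ} {ω : ℕ → Fin n} {u j : ℕ} {s : State}
    (hk : 0 < k) (hE : Env k n u W j s.mem) (hy : ∀ i < k, s.mem (20 + i) < n) :
    Reach H W ω (checkTuple k) s (4 * k + 7) fun s' =>
      (∀ d, d < 6 ∨ 14 < d → s'.mem d = s.mem d) ∧
      (s'.mem 6 ≠ 0 ↔ s.mem 6 ≠ 0 ∨ Violates H j fun i => s.mem (20 + i)) := by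
  classical
  have hW := hE.space
  have harr : 20 < arr k := by unfold arr; omega
  have h1 : 1 % W = 1 := Nat.mod_eq_of_lt (by omega)
  apply Reach.instr_seq
  apply Reach.instr_seq
  apply Reach.instr_seq
  have key : ∀ d, d < 10 ∨ 14 < d → ((Instr.const (k := k) 14 0).step H W ω
      ((Instr.const 13 0).step H W ω ((Instr.query 10 fun i => 20 + i).step H W ω s))).mem d
        = s.mem d := by
    intro d hd
    simp only [Instr.step]
    rw [Function.update_of_ne (by omega), Function.update_of_ne (by omega),
      Function.update_of_ne (by omega)]
  have h10 : ((Instr.const (k := k) 14 0).step H W ω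
      ((Instr.const 13 0).step H W ω ((Instr.query 10 fun i => 20 + i).step H W ω s))).mem 10
        = if H.IsEdgeTuple (fun i => s.mem (20 + i)) then 1 else 0 := by
    simp [Instr.step]
  have h13 : ((Instr.const (k := k) 14 0).step H W ω
      ((Instr.const 13 0).step H W ω ((Instr.query 10 fun i => 20 + i).step H W ω s))).mem 13
        = 0 := by
    simp [Instr.step]
  have h14 : ((Instr.const (k := k) 14 0).step H W ω
      ((Instr.const 13 0).step H W ω ((Instr.query 10 fun i => 20 + i).step H W ω s))).mem 14
        = 0 := by
    simp [Instr.step]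
  generalize (Instr.const (k := k) 14 0).step H W ω
      ((Instr.const 13 0).step H W ω ((Instr.query 10 fun i => 20 + i).step H W ω s)) = s₁
    at key h10 h13 h14 ⊢
  have hE₁ : Env k n u W j s₁.mem := hE.congr fun d hd => key d (by unfold arr at hd; omega)
  have hy₁ : ∀ i < k, s₁.mem (20 + i) < n := fun i hi => by
    rw [key _ (by omega)]; exact hy i hi
  have hscan := reach_scanColors (H := H) (ω := ω) hE₁ h13 h14 k le_rfl hy₁
  refine Reach.mono (Reach.seq (T' := 3) (hscan.mono le_rfl ?_)) (by omega) fun _ h => h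
  rintro s₂ ⟨hm, hm13, hm14⟩
  have hkey : ∀ i, s₁.mem (20 + i) = s.mem (20 + i) := fun i => key _ (by omega)
  simp only [hkey] at hm13 hm14
  have h10' : s₂.mem 10 = if H.IsEdgeTuple (fun i => s.mem (20 + i)) then 1 else 0 := by
    rw [hm _ (by omega), h10]
  have hsum : (s₂.mem 13 + s₂.mem 14) % W = s₂.mem 13 + s₂.mem 14 := by
    apply Nat.mod_eq_of_lt
    rw [hm13, hm14]
    split_ifs <;> omega
  -- As `k > 0`, at least one color occurs, so the two flags sum to `1` or `2`. The query answer is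
  -- not below this sum exactly when it is `1` and only one color occurs.
  have hviol : ¬ (s₂.mem 10 < s₂.mem 13 + s₂.mem 14) ↔
      Violates H j fun i => s.mem (20 + i) := by
    rw [h10', hm13, hm14]
    unfold Violates
    have hor : (∃ i < k, j.testBit (s.mem (20 + i)) = false) ∨
        ∃ i < k, j.testBit (s.mem (20 + i)) = true := by
      cases hb : j.testBit (s.mem (20 + 0))
      · exact Or.inl ⟨0, hk, hb⟩
      · exact Or.inr ⟨0, hk, hb⟩
    by_cases ha : ∃ i < k, j.testBit (s.mem (20 + i)) = false <;>
    by_cases hb : ∃ i < k, j.testBit (s.mem (20 + i)) = true <;>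
    by_cases he : H.IsEdgeTuple (fun i : Fin k => s.mem (20 + i)) <;>
    simp only [ha, hb, he, if_true, if_false] <;> simp [ha, hb] at hor ⊢
  apply Reach.instr_seq
  apply Reach.ite
  · intro hlt
    apply Reach.instr
    simp only [Instr.step, hsum] at hlt ⊢
    rw [Function.update_self, Function.update_of_ne (by omega)] at hlt
    refine ⟨fun d hd => ?_, ?_⟩
    · rw [Function.update_of_ne (by omega), hm d (by omega), key d (by omega)]
    · rw [Function.update_of_ne (by omega), hm _ (by omega), key _ (by omega), ← hviol]
      simp [hlt]
  · intro hlt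
    apply Reach.instr
    simp only [Instr.step, hsum] at hlt ⊢
    rw [Function.update_self, Function.update_of_ne (by omega), hviol] at hlt
    refine ⟨fun d hd => ?_, ?_⟩
    · rw [Function.update_of_ne (by omega), Function.update_of_ne (by omega), hm d (by omega),
        key d (by omega)]
    · simp [h1, hlt]

/-- Run `checkTuple` for all values below `n` of the first `j` entries of the tuple. -/
def checkTuples (k : ℕ) : ℕ → Prog k
  | 0 => checkTuple k
  | j + 1 => .seq (.instr (.const (20 + j) 0)) (.loop (20 + j) 1
      (.seq (checkTuples k j) (.instr (.add (20 + j) (20 + j) 3))))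

/-- A bound for the running time of `checkTuples`. -/
def checkTime (k n : ℕ) : ℕ → ℕ
  | 0 => 4 * k + 7
  | j + 1 => n * (checkTime k n j + 1 + 1) + 1 + 1

/-- Induction on the nesting depth `j`: the entries from position `j` on are fixed by the outer
loops, and the flag in cell `6` is only ever raised. -/
theorem reach_checkTuples {H : KGraph k n} {W : ℕ} {ω : ℕ → Fin n} {u c : ℕ}
    (hk : 0 < k) (j : ℕ) (hjk : j ≤ k) {s : State} (hE : Env k n u W c s.mem)
    (hy : ∀ i, j ≤ i → i < k → s.mem (20 + i) < n) :
    Reach H W ω (checkTuples k j) s (checkTime k n j) fun s' =>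
      (∀ d, d < 6 ∨ (14 < d ∧ d < 20) ∨ 20 + j ≤ d → s'.mem d = s.mem d) ∧
      (s'.mem 6 ≠ 0 ↔ s.mem 6 ≠ 0 ∨ ∃ y : ℕ → ℕ, (∀ i < j, y i < n) ∧
        (∀ i, j ≤ i → i < k → y i = s.mem (20 + i)) ∧ Violates H c y) := by
  induction j generalizing s with
  | zero =>
    refine (reach_checkTuple hk hE fun i hi => hy i (by omega) hi).mono le_rfl ?_
    rintro s' ⟨hm, h6⟩
    refine ⟨fun d hd => hm d (by omega), h6.trans (or_congr_right ⟨fun hv => ?_, ?_⟩)⟩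
    · exact ⟨_, by simp, fun i _ _ => rfl, hv⟩
    · rintro ⟨y, -, hy, hv⟩
      exact (Violates.congr fun i hi => hy i (by omega) hi).1 hv
  | succ j ih =>
    have hW := hE.space
    have harr : 20 + j < arr k := by unfold arr; omega
    apply Reach.instr_seq
    set s₀ := (Instr.const (k := k) (20 + j) 0).step H W ω s with hs₀
    have hs : ∀ d, d ≠ 20 + j → s₀.mem d = s.mem d := fun d hd => by
      simp only [hs₀, Instr.step]
      rw [Function.update_of_ne hd]
    refine (Reach.loop n (fun t s' => t ≤ n ∧ s'.mem (20 + j) = t ∧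
      (∀ d, d < 6 ∨ (14 < d ∧ d < 20) ∨ 20 + (j + 1) ≤ d → s'.mem d = s.mem d) ∧
      (s'.mem 6 ≠ 0 ↔ s.mem 6 ≠ 0 ∨ ∃ y : ℕ → ℕ, (∀ i < j, y i < n) ∧ y j < t ∧
        (∀ i, j + 1 ≤ i → i < k → y i = s.mem (20 + i)) ∧ Violates H c y)) ?_ ?_ ?_).mono le_rfl ?_
    · rintro t s₁ htn ⟨-, hjt, hm, h6⟩
      have hE₁ : Env k n u W c s₁.mem := hE.congr fun d hd => hm d (by unfold arr at hd; omega)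
      refine ⟨by rw [hjt, hE₁.size]; exact htn, Reach.seq (T' := 1)
        ((ih (by omega) hE₁ ?_).mono le_rfl ?_)⟩
      · intro i hi hik
        rcases hi.eq_or_lt with rfl | hi
        · rw [hjt]; exact htn
        · rw [hm _ (by omega)]; exact hy i (by omega) hik
      · rintro s₂ ⟨hm₂, h6₂⟩
        apply Reach.instr
        have hE₂ : Env k n u W c s₂.mem := hE₁.congr fun d hd =>
          hm₂ d (by unfold arr at hd; omega)
        refine ⟨by omega, ?_, fun d hd => ?_, ?_⟩
        · simp only [Instr.step, Function.update_self]
          rw [hm₂ _ (by omega), hjt, hE₂.one, Nat.mod_eq_of_lt (by omega)]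
        · simp only [Instr.step]
          rw [Function.update_of_ne (by omega), hm₂ d (by omega), hm d hd]
        · simp only [Instr.step]
          rw [Function.update_of_ne (by omega), h6₂, h6, or_assoc]
          refine or_congr_right ⟨?_, ?_⟩
          · rintro (⟨y, h1, h2, h3, h4⟩ | ⟨y, h1, h2, h3⟩)
            · exact ⟨y, h1, by omega, h3, h4⟩
            · refine ⟨y, h1, ?_, fun i hi hik => ?_, h3⟩
              · rw [h2 j le_rfl (by omega), hjt]; omega
              · rw [h2 i (by omega) hik, hm _ (by omega)]
          · rintro ⟨y, h1, h2, h3, h4⟩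
            rcases (Nat.lt_succ_iff.1 h2).eq_or_lt with h | h
            · refine Or.inr ⟨y, h1, fun i hi hik => ?_, h4⟩
              rcases hi.eq_or_lt with rfl | hi
              · rw [h, hjt]
              · rw [h3 i hi hik, hm _ (by omega)]
            · exact Or.inl ⟨y, h1, h, h3, h4⟩
    · rintro s₁ ⟨-, hjt, hm, -⟩
      rw [hjt, hm 1 (by omega), hE.size]
      omega
    · refine ⟨by omega, by simp [hs₀, Instr.step], fun d hd => hs d (by omega), ?_⟩
      rw [hs 6 (by omega)]
      simp
    · rintro s₁ ⟨-, -, hm, h6⟩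
      refine ⟨hm, h6.trans (or_congr_right (exists_congr fun y => ?_))⟩
      constructor
      · rintro ⟨h1, h2, h3, h4⟩
        refine ⟨fun i hi => ?_, h3, h4⟩
        rcases (Nat.lt_succ_iff.1 hi).eq_or_lt with rfl | h
        · exact h2
        · exact h1 i h
      · rintro ⟨h1, h3, h4⟩
        exact ⟨fun i hi => h1 i (by omega), h1 j (by omega), h3, h4⟩

/-- The coloring whose colors are the bits of `j`. -/
def bitColoring (n j : ℕ) (v : Fin n) : Fin 2 := if j.testBit v then 1 else 0

/-- Running over ordered tuples loses nothing: every edge has an enumeration, and a tuple with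
repetitions is not an edge because its image has fewer than `k` elements. -/
theorem exists_violates_iff (H : KGraph k n) (j : ℕ) :
    (∃ y : ℕ → ℕ, (∀ i < k, y i < n) ∧ Violates H j y) ↔
      ¬ H.IsLegalColoring (bitColoring n j) := by
  classical
  unfold KGraph.IsLegalColoring bitColoring Violates
  constructor
  · rintro ⟨y, hy, ⟨w, hw, he⟩, hv⟩ hl
    obtain ⟨a, ha, b, hb, hab⟩ := hl _ he
    simp only [Finset.mem_image, Finset.mem_univ, true_and] at ha hb
    obtain ⟨i, rfl⟩ := ha
    obtain ⟨i', rfl⟩ := hb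
    rw [← hw, ← hw] at hab
    apply hv
    cases h1 : j.testBit (y i) <;> cases h2 : j.testBit (y i') <;> simp [h1, h2] at hab
    · exact ⟨⟨i, i.2, h1⟩, ⟨i', i'.2, h2⟩⟩
    · exact ⟨⟨i', i'.2, h2⟩, ⟨i, i.2, h1⟩⟩
  · intro h
    push Not at h
    obtain ⟨e, he, hc⟩ := h
    have hcard := H.2 e he
    let f := e.equivFinOfCardEq hcard
    have himg : Finset.univ.image (fun i => (f.symm i : Fin n)) = e := by
      ext x
      simp only [Finset.mem_image, Finset.mem_univ, true_and]
      constructor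
      · rintro ⟨i, rfl⟩
        exact (f.symm i).2
      · intro hx
        exact ⟨f ⟨x, hx⟩, by simp⟩
    -- Entries at indices `≥ k` are never examined, so their default value `0` is harmless.
    refine ⟨fun i => if h : i < k then (f.symm ⟨i, h⟩ : Fin n) else 0, fun i hi => by simp [hi],
      ⟨fun i => f.symm i, fun i => by simp, by rwa [himg]⟩, ?_⟩
    rintro ⟨⟨i, hi, h1⟩, i', hi', h2⟩
    have := hc _ (f.symm ⟨i, hi⟩).2 _ (f.symm ⟨i', hi'⟩).2
    simp only [hi, hi', dif_pos] at h1 h2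
    simp [h1, h2] at this

/-- Set cell `6` to `0` if the coloring in the array is legal, and to `1` otherwise. -/
def checkColoring (k : ℕ) : Prog k := .seq (.instr (.const 6 0)) (checkTuples k k)

theorem reach_checkColoring {H : KGraph k n} {W : ℕ} {ω : ℕ → Fin n} {u j : ℕ}
    (hk : 0 < k) {s : State} (hE : Env k n u W j s.mem) :
    Reach H W ω (checkColoring k) s (checkTime k n k + 1) fun s' =>
      Env k n u W j s'.mem ∧
      (s'.mem 6 ≠ 0 ↔ ¬ H.IsLegalColoring (bitColoring n j)) := by
  apply Reach.instr_seq
  have hE' : Env k n u W j ((Instr.const (k := k) 6 0).step H W ω s).mem :=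
    hE.congr fun d hd => by
      simp only [Instr.step]
      rw [Function.update_of_ne (by unfold arr at hd; omega)]
  refine (reach_checkTuples hk k le_rfl hE' fun i h h' => by omega).mono le_rfl ?_
  rintro s' ⟨hm, h6⟩
  refine ⟨hE'.congr fun d hd => hm d (by unfold arr at hd; omega), h6.trans ?_⟩
  rw [← exists_violates_iff]
  simp only [Instr.step, Function.update_self]
  simp only [Nat.zero_mod, ne_eq, not_true_eq_false, false_or]
  refine exists_congr fun y => and_congr_right fun _ => ⟨fun h => h.2, fun h => ⟨fun i h h' => ?_, h⟩⟩
  omega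

/-! ### Gadgets that force the color of a vertex -/

/-- The vertices of a sample `r`, and the additional vertex `w`. -/
def extend {m : ℕ} (r : Fin m → Fin n) (w : Fin n) : Option (Fin m) → Fin n
  | none => w
  | some i => r i

/-- All `k`-subsets of the sample `r` with the additional vertex `w` are edges, with the possible
exception of `{w} ∪ {r i | i ∈ Y}`. -/
def Cert (H : KGraph k n) {m : ℕ} (r : Fin m → Fin n) (w : Fin n) (Y : Finset (Fin m)) : Prop :=
  ∀ e : Finset (Option (Fin m)), e.card = k → e ≠ Finset.insertNone Y →
    e.image (extend r w) ∈ H.1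

theorem fin_two_eq_of_ne {a b c : Fin 2} (hab : a ≠ c) (hbc : b ≠ c) : a = b := by
  omega

/-- A monochromatic `k`-subset can only be the exceptional one, which contains `w`. Hence each color
occurs at most `k-1` times among the `2(k-1)` sample points, so exactly `k-1` of them share the
color of `w`. Together with `w` they form a monochromatic `k`-set, which must be the exceptional
one. -/
theorem Cert.color_eq_iff {H : KGraph k n} {r : Fin (2 * (k - 1)) → Fin n} {w : Fin n}
    {Y : Finset (Fin (2 * (k - 1)))} (h : Cert H r w Y) (hk : 0 < k) {c : Fin n → Fin 2}
    (hc : H.IsLegalColoring c) (i : Fin (2 * (k - 1))) : c (r i) = c w ↔ i ∈ Y := by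
  have mono : ∀ (e : Finset (Option (Fin (2 * (k - 1))))) (a : Fin 2), e.card = k →
      (∀ x ∈ e, c (extend r w x) = a) → e = Finset.insertNone Y := by
    intro e a he ha
    by_contra hne
    obtain ⟨v, hv, v', hv', hvv⟩ := hc _ (h e he hne)
    obtain ⟨x, hx, rfl⟩ := Finset.mem_image.1 hv
    obtain ⟨x', hx', rfl⟩ := Finset.mem_image.1 hv'
    exact hvv (by rw [ha x hx, ha x' hx'])
  have small : ∀ (S : Finset (Fin (2 * (k - 1)))) (a : Fin 2), (∀ i ∈ S, c (r i) = a) →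
      S.card ≤ k - 1 := by
    intro S a hS
    by_contra! hlt
    obtain ⟨S', hS', hcard⟩ := Finset.exists_subset_card_eq (show k ≤ S.card by omega)
    have := mono (S'.map Function.Embedding.some) a (by rw [Finset.card_map, hcard]) ?_
    · have hn : none ∈ Finset.insertNone Y := by simp
      rw [← this] at hn
      simp at hn
    · intro x hx
      obtain ⟨i, hi, rfl⟩ := Finset.mem_map.1 hx
      exact hS i (hS' hi)
  set T := Finset.univ.filter fun i => c (r i) = c w with hT
  have h1 : T.card ≤ k - 1 := small T (c w) fun i hi => by simpa [hT] using hi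
  have h2 : Tᶜ.card ≤ k - 1 := by
    rcases Tᶜ.eq_empty_or_nonempty with h0 | ⟨i₀, hi₀⟩
    · simp [h0]
    · refine small Tᶜ (c (r i₀)) fun i hi => fin_two_eq_of_ne (c := c w) ?_ ?_
      · simpa [hT] using hi
      · simpa [hT] using hi₀
  have h3 := Finset.card_add_card_compl T
  rw [Fintype.card_fin] at h3
  have := mono (Finset.insertNone T) (c w) (by rw [Finset.card_insertNone]; omega) ?_
  · have hTY : T = Y := Finset.insertNone.injective this
    rw [← hTY]
    simp [hT]
  · intro x hx
    cases x with
    | none => rfl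
    | some i => exact (by simpa [hT] using hx : c (r i) = c w)

/-- The second half of the positions of a sample. -/
def half (k : ℕ) : Finset (Fin (2 * (k - 1))) := Finset.univ.filter fun i => k - 1 ≤ i

theorem card_half (k : ℕ) : (half k).card = k - 1 := by
  have h : half k = Finset.univ.map (Fin.natAddEmb (k - 1) |>.trans
      (Fin.castOrderIso (show (k - 1) + (k - 1) = 2 * (k - 1) by omega)).toEmbedding) := by
    ext i
    simp only [half, Finset.mem_filter, Finset.mem_univ, true_and, Finset.mem_map]
    constructor
    · intro hi
      refine ⟨⟨i - (k - 1), by omega⟩, ?_⟩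
      ext
      simp
      omega
    · rintro ⟨a, rfl⟩
      simp
  rw [h, Finset.card_map, Finset.card_univ, Fintype.card_fin]

/-- The sample `r` witnesses that `u` and `v` have the same color. -/
def Same (H : KGraph k n) (r : Fin (2 * (k - 1)) → Fin n) (u v : Fin n) : Prop :=
  Cert H r u (half k) ∧ Cert H r v (half k)

/-- The sample `r` witnesses that `u` and `v` have different colors. -/
def Diff (H : KGraph k n) (r : Fin (2 * (k - 1)) → Fin n) (u v : Fin n) : Prop :=
  Cert H r u (half k) ∧ Cert H r v (half k)ᶜ

/-- The sample `r` determines whether `u` and `v` have the same color. -/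
def Decides (H : KGraph k n) (r : Fin (2 * (k - 1)) → Fin n) (u v : Fin n) : Prop :=
  Same H r u v ∨ Diff H r u v

theorem Same.color_eq {H : KGraph k n} {r : Fin (2 * (k - 1)) → Fin n} {u v : Fin n}
    (h : Same H r u v) (hk : 2 ≤ k) {c : Fin n → Fin 2} (hc : H.IsLegalColoring c) :
    c u = c v := by
  obtain ⟨i, hi⟩ : (half k).Nonempty := by rw [← Finset.card_pos, card_half]; omega
  rw [← (h.1.color_eq_iff (by omega) hc i).2 hi, ← (h.2.color_eq_iff (by omega) hc i).2 hi]

theorem Diff.color_ne {H : KGraph k n} {r : Fin (2 * (k - 1)) → Fin n} {u v : Fin n}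
    (h : Diff H r u v) (hk : 2 ≤ k) {c : Fin n → Fin 2} (hc : H.IsLegalColoring c) :
    c u ≠ c v := by
  obtain ⟨i, hi⟩ : (half k).Nonempty := by rw [← Finset.card_pos, card_half]; omega
  rw [← (h.1.color_eq_iff (by omega) hc i).2 hi, Ne, h.2.color_eq_iff (by omega) hc i]
  simpa using hi

/-- An enumeration of a `k`-element set. -/
noncomputable def tuple {α : Type*} (k : ℕ) (e : Finset (Option α)) (i : Fin k) : Option α :=
  if h : e.card = k then (e.equivFinOfCardEq h).symm i else none

theorem image_tuple {α : Type*} [DecidableEq α] {k : ℕ} {e : Finset (Option α)}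
    (h : e.card = k) : Finset.univ.image (tuple k e) = e := by
  ext x
  simp only [Finset.mem_image, Finset.mem_univ, true_and, tuple, h, dif_pos]
  constructor
  · rintro ⟨i, rfl⟩
    exact ((e.equivFinOfCardEq h).symm i).2
  · intro hx
    exact ⟨e.equivFinOfCardEq h ⟨x, hx⟩, by simp⟩

/-- The addresses of the points of the gadget, where the additional vertex is in cell `a`. -/
def addr {m : ℕ} (a : ℕ) : Option (Fin m) → ℕ
  | none => a
  | some i => 20 + i

/-- The queries that test `Cert` for the additional vertex in cell `a`. -/
noncomputable def queries (k : ℕ) (a : ℕ) (Y : Finset (Fin (2 * (k - 1)))) :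
    List (Fin k → ℕ) :=
  ((Finset.univ : Finset (Finset (Option (Fin (2 * (k - 1)))))).filter
    fun e => e.card = k ∧ e ≠ Finset.insertNone Y).toList.map fun e i => addr a (tuple k e i)

/-- Cells `9` and `10` are overwritten between the queries, so no query may read its vertices from
them. -/
theorem mem_queries_ne {a : ℕ} {Y : Finset (Fin (2 * (k - 1)))} {f : Fin k → ℕ} (ha : a < 9)
    (hf : f ∈ queries k a Y) (i : Fin k) : f i ≠ 9 ∧ f i ≠ 10 := by
  obtain ⟨e, -, rfl⟩ := List.mem_map.1 hf
  dsimp only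
  cases tuple k e i <;> simp only [addr] <;> omega

theorem forall_queries_iff {H : KGraph k n} {r : Fin (2 * (k - 1)) → Fin n} {w : Fin n} {a : ℕ}
    {Y : Finset (Fin (2 * (k - 1)))} {m : ℕ → ℕ} (hr : ∀ i : Fin _, m (20 + i) = r i) (hw : m a = w) :
    (∀ f ∈ queries k a Y, H.IsEdgeTuple fun i => m (f i)) ↔ Cert H r w Y := by
  have hm : ∀ x : Option (Fin (2 * (k - 1))), m (addr a x) = extend r w x := by
    intro x
    cases x with
    | none => exact hw
    | some i => exact hr i
  simp only [queries, List.mem_map, Finset.mem_toList, Finset.mem_filter, Finset.mem_univ,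
    true_and, forall_exists_index, and_imp, Cert]
  constructor
  · intro h e he hne
    obtain ⟨v, hv, he'⟩ := h _ e he hne rfl
    have : v = fun i => extend r w (tuple k e i) := by
      ext i
      rw [← hv, ← hm]
    rw [this] at he'
    rw [← image_tuple he, Finset.image_image]
    exact he'
  · rintro h _ e he hne rfl
    refine ⟨fun i => extend r w (tuple k e i), fun i => hm _, ?_⟩
    have := h e he hne
    rwa [← image_tuple he, Finset.image_image] at this

/-! ### Brute force: the first legal coloring -/

/-- The bits `0, …, t` of `a` vanish, so the addition produces no carry. -/
theorem testBit_add_two_pow {a t : ℕ} (h : 2 ^ (t + 1) ∣ a) (i : ℕ) :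
    (a + 2 ^ t).testBit i = if i = t then true else a.testBit i := by
  obtain ⟨b, rfl⟩ := h
  rw [Nat.testBit_two_pow_mul_add _ (Nat.pow_lt_pow_right (by norm_num) (Nat.lt_succ_self t)),
    Nat.testBit_two_pow, Nat.testBit_two_pow_mul]
  by_cases h1 : i < t + 1
  · by_cases h2 : t = i
    · simp [h2]
    · simp [h1, h2, Ne.symm h2, show ¬ t + 1 ≤ i by omega]
  · simp [h1, show i ≠ t by omega, show t + 1 ≤ i by omega]

theorem testBit_of_dvd {a t : ℕ} (h : 2 ^ (t + 1) ∣ a) : a.testBit t = false := by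
  obtain ⟨b, rfl⟩ := h
  rw [Nat.testBit_two_pow_mul]
  simp

/-- Add one to the binary number in the array. -/
def increment (k : ℕ) : Prog k :=
  .seq (.instr (.add 11 4 5)) (.seq (.instr (.load 12 11)) (.seq
    (.loop 5 12 (.seq (.instr (.store 11 5)) (.seq (.instr (.add 11 11 3))
      (.instr (.load 12 11))))) (.instr (.store 11 3))))

theorem Env.store {u W j t b : ℕ} {s : State} (h : Env k n u W j s.mem) (h11 : s.mem 11 = arr k + t)
    {j' : ℕ} (hb : s.mem b = (j'.testBit t).toNat)
    (hj : ∀ i, i ≠ t → j'.testBit i = j.testBit i) {H : KGraph k n} {ω : ℕ → Fin n} :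
    Env k n u W j' ((Instr.store (k := k) 11 b).step H W ω s).mem := by
  have harr : 20 ≤ arr k := by unfold arr; omega
  have hs : ∀ d, d < 6 → ((Instr.store (k := k) 11 b).step H W ω s).mem d = s.mem d := by
    intro d hd
    simp only [Instr.step, h11]
    rw [Function.update_of_ne (by omega)]
  refine ⟨?_, ?_, ?_, ?_, ?_, ?_, fun i => ?_, h.vertex_lt, h.space⟩
  · rw [hs _ (by omega), h.vertex]
  · rw [hs _ (by omega), h.size]
  · rw [hs _ (by omega), h.ref]
  · rw [hs _ (by omega), h.one]
  · rw [hs _ (by omega), h.base]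
  · rw [hs _ (by omega), h.zero]
  · simp only [Instr.step, h11]
    by_cases hi : i = t
    · rw [hi, Function.update_self, hb]
    · rw [Function.update_of_ne (by omega), h.bits, hj i hi]

theorem reach_increment {H : KGraph k n} {W : ℕ} {ω : ℕ → Fin n} {u j : ℕ} (hj : j + 1 < 2 ^ n)
    {s : State} (hE : Env k n u W j s.mem) :
    Reach H W ω (increment k) s (4 * n + 4) fun s' => Env k n u W (j + 1) s'.mem := by
  have harr : 20 ≤ arr k := by unfold arr; omega
  have hW := hE.space
  -- `N` is the number of trailing ones of `j`, the length of the carry. The bound `j + 1 < 2 ^ n`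
  -- gives `N < n`, which keeps the carry inside the array and limits its running time.
  obtain ⟨N, q, hq, hN⟩ := Nat.exists_eq_two_pow_mul_odd (Nat.succ_ne_zero j)
  rw [Nat.succ_eq_add_one] at hN
  obtain ⟨b, rfl⟩ := hq
  have hNn : N < n := by
    by_contra! h
    have h1 : 2 ^ n ≤ 2 ^ N := Nat.pow_le_pow_right (by norm_num) h
    have h2 : 2 ^ N ≤ 2 ^ N * (2 * b + 1) := Nat.le_mul_of_pos_right _ (by omega)
    omega
  have hval : ∀ t ≤ N, 2 ^ t ≤ j + 1 := fun t ht => by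
    rw [hN]
    exact (Nat.pow_le_pow_right (by norm_num) ht).trans (Nat.le_mul_of_pos_right _ (by omega))
  have hdvd : ∀ t < N, 2 ^ (t + 1) ∣ j + 1 - 2 ^ (t + 1) := fun t ht => by
    refine Nat.dvd_sub ?_ dvd_rfl
    rw [hN]
    exact (pow_dvd_pow 2 (by omega)).mul_right _
  have hstep : ∀ t < N, j + 1 - 2 ^ t = (j + 1 - 2 ^ (t + 1)) + 2 ^ t := fun t ht => by
    have := hval (t + 1) (by omega)
    rw [pow_succ] at this ⊢
    omega
  have hlast : 2 ^ (N + 1) ∣ j + 1 - 2 ^ N :=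
    ⟨b, by rw [hN, mul_add, mul_one, Nat.add_sub_cancel, pow_succ, mul_assoc]⟩
  have hbit : ∀ t ≤ N, (j + 1 - 2 ^ t).testBit t = decide (t < N) := by
    intro t ht
    rcases ht.eq_or_lt with rfl | ht
    · simp [testBit_of_dvd hlast]
    · rw [hstep t ht, testBit_add_two_pow (hdvd t ht)]
      simp [ht]
  apply Reach.instr_seq
  apply Reach.instr_seq
  -- Clearing the `t` lowest ones of `j` leaves `j - (2 ^ t - 1) = j + 1 - 2 ^ t`; writing a one at
  -- position `N` after the loop then yields `j + 1`.
  refine Reach.mono (Reach.seq (T' := 1) ((Reach.loop N (fun t s' => t ≤ N ∧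
    Env k n u W (j + 1 - 2 ^ t) s'.mem ∧ s'.mem 11 = arr k + t ∧
      s'.mem 12 = (decide (t < N)).toNat) (T := 3) ?_ ?_ ?_).mono le_rfl ?_)) (T := N * 4 + 1 + 1)
        (by omega) fun _ h => h
  · rintro t s₁ htN ⟨-, hE₁, h11, h12⟩
    refine ⟨by rw [hE₁.zero, h12]; simp [htN], ?_⟩
    apply Reach.instr_seq
    have hE₂ : Env k n u W (j + 1 - 2 ^ (t + 1))
        ((Instr.store (k := k) 11 5).step H W ω s₁).mem := by
      refine hE₁.store h11 ?_ ?_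
      · rw [hE₁.zero, testBit_of_dvd (hdvd t htN)]
        rfl
      · intro i hi
        rw [hstep t htN, testBit_add_two_pow (hdvd t htN), if_neg hi]
    have h11' : ((Instr.store (k := k) 11 5).step H W ω s₁).mem 11 = arr k + t := by
      simp only [Instr.step, h11]
      rw [Function.update_of_ne (by omega), h11]
    generalize (Instr.store (k := k) 11 5).step H W ω s₁ = s₂ at hE₂ h11'
    apply Reach.instr_seq
    apply Reach.instr
    have hadd : (arr k + t + 1) % W = arr k + (t + 1) := Nat.mod_eq_of_lt (by omega)
    refine ⟨htN, hE₂.congr fun d hd => ?_, ?_, ?_⟩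
    · simp only [Instr.step]
      rw [Function.update_of_ne (by omega), Function.update_of_ne (by omega)]
    · simp [Instr.step, h11', hE₂.one, hadd]
    · simp only [Instr.step, h11', hE₂.one, hadd, Function.update_self]
      rw [Function.update_of_ne (by omega), hE₂.bits, hbit _ (by omega)]
  · rintro s₁ ⟨-, hE₁, -, h12⟩
    rw [hE₁.zero, h12]
    simp
  · have hadd : (arr k + 0) % W = arr k + 0 := Nat.mod_eq_of_lt (by omega)
    refine ⟨by omega, hE.congr fun d hd => ?_, ?_, ?_⟩
    · simp only [Instr.step]
      rw [Function.update_of_ne (by omega), Function.update_of_ne (by omega)]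
    · simpa [Instr.step, hE.base, hE.zero] using hadd
    · simp only [Instr.step, hE.base, hE.zero, hadd, Function.update_self]
      rw [Function.update_of_ne (by omega), hE.bits, ← hbit 0 (by omega)]
      simp
  · rintro s₁ ⟨-, hE₁, h11, -⟩
    apply Reach.instr
    have hj1 : j + 1 = (j + 1 - 2 ^ N) + 2 ^ N := (Nat.sub_add_cancel (hval N le_rfl)).symm
    refine hE₁.store h11 ?_ ?_
    · rw [hE₁.one, hj1, testBit_add_two_pow hlast]
      simp
    · intro i hi
      conv_lhs => rw [hj1, testBit_add_two_pow hlast, if_neg hi]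

theorem exists_bitColoring (c : Fin n → Fin 2) : ∃ j < 2 ^ n, bitColoring n j = c := by
  refine ⟨Nat.ofBits fun i => decide (c i = 1), Nat.ofBits_lt_two_pow _, ?_⟩
  ext v
  simp only [bitColoring]
  rw [Nat.testBit_ofBits_lt _ _ v.2]
  simp only [Fin.eta, decide_eq_true_eq]
  split_ifs with h
  · rw [h]
  · omega

/-- The index of the first legal coloring. -/
noncomputable def firstLegal (H : KGraph k n) : ℕ :=
  sInf {j | H.IsLegalColoring (bitColoring n j)}

theorem firstLegal_spec {H : KGraph k n} (hH : H.TwoColorable) :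
    H.IsLegalColoring (bitColoring n (firstLegal H)) ∧ firstLegal H < 2 ^ n := by
  obtain ⟨c, hc⟩ := hH
  obtain ⟨j, hj, rfl⟩ := exists_bitColoring c
  have hne : {j | H.IsLegalColoring (bitColoring n j)}.Nonempty := ⟨j, hc⟩
  exact ⟨Nat.sInf_mem hne, (Nat.sInf_le (m := j) hc).trans_lt hj⟩

theorem not_legal_of_lt_firstLegal {H : KGraph k n} {j : ℕ} (hj : j < firstLegal H) :
    ¬ H.IsLegalColoring (bitColoring n j) := fun h => Nat.notMem_of_lt_sInf hj h

/-- The first legal coloring, normalized so that `v` has color `0`. -/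
noncomputable def canonColoring (H : KGraph k n) (v w : Fin n) : Fin 2 :=
  if (firstLegal H).testBit w = (firstLegal H).testBit v then 0 else 1

/-- The normalization is at most a global exchange of the two colors. -/
theorem canonColoring_legal {H : KGraph k n} (hH : H.TwoColorable) (v : Fin n) :
    H.IsLegalColoring (canonColoring H v) := by
  intro e he
  obtain ⟨x, hx, y, hy, hxy⟩ := (firstLegal_spec hH).1 e he
  refine ⟨x, hx, y, hy, ?_⟩
  simp only [bitColoring, canonColoring] at hxy ⊢
  cases h1 : (firstLegal H).testBit x <;> cases h2 : (firstLegal H).testBit y <;>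
    cases h3 : (firstLegal H).testBit v <;> simp_all

theorem canonColoring_self (H : KGraph k n) (v : Fin n) : canonColoring H v v = 0 := by
  simp [canonColoring]

/-- Compare the colors of the vertex and of the reference vertex. -/
def output (k : ℕ) : Prog k :=
  .seq (.instr (.add 11 4 0)) (.seq (.instr (.load 12 11)) (.seq (.instr (.add 11 4 2))
    (.seq (.instr (.load 13 11)) (.ite 12 13 (.instr (.const 0 1))
      (.ite 13 12 (.instr (.const 0 1)) (.instr (.const 0 0)))))))

theorem reach_output {H : KGraph k n} {W : ℕ} {ω : ℕ → Fin n} {u v : Fin n} (hv : (v : ℕ) = n - 1)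
    {s : State} (hE : Env k n u W (firstLegal H) s.mem) :
    Reach H W ω (output k) s 7 fun s' => s'.mem 0 = canonColoring H v u := by
  have harr : 20 ≤ arr k := by unfold arr; omega
  have hW := hE.space
  have hu := u.2
  have hadd : (arr k + u) % W = arr k + u := Nat.mod_eq_of_lt (by omega)
  have hadd' : (arr k + (n - 1)) % W = arr k + v := by
    rw [Nat.mod_eq_of_lt (by omega), hv]
  have h1 : 1 % W = 1 := Nat.mod_eq_of_lt (by omega)
  iterate 4 apply Reach.instr_seq
  set s₁ := (Instr.load (k := k) 13 11).step H W ω ((Instr.add 11 4 2).step H W ω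
    ((Instr.load 12 11).step H W ω ((Instr.add 11 4 0).step H W ω s))) with hs₁
  have h13 : s₁.mem 13 = ((firstLegal H).testBit v).toNat := by
    simp only [hs₁, Instr.step, Function.update_self]
    rw [Function.update_of_ne (show 4 ≠ 12 by omega), Function.update_of_ne (show 4 ≠ 11 by omega),
      Function.update_of_ne (show 2 ≠ 12 by omega), Function.update_of_ne (show 2 ≠ 11 by omega),
      hE.base, hE.ref, hadd', Function.update_of_ne (by omega), Function.update_of_ne (by omega),
      Function.update_of_ne (by omega), hE.bits]
  have h12 : s₁.mem 12 = ((firstLegal H).testBit u).toNat := by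
    simp only [hs₁, Instr.step, Function.update_self]
    rw [Function.update_of_ne (by omega), Function.update_of_ne (by omega), Function.update_self,
      hE.base, hE.vertex, hadd, Function.update_of_ne (by omega), hE.bits]
  unfold canonColoring
  apply Reach.ite
  · intro h
    apply Reach.instr
    rw [h12, h13] at h
    have : (firstLegal H).testBit u ≠ (firstLegal H).testBit v := fun e => by
      simp [e] at h
    simp [Instr.step, this, h1]
  · intro h
    apply Reach.ite
    · intro h'
      apply Reach.instr
      rw [h12, h13] at h'
      have : (firstLegal H).testBit u ≠ (firstLegal H).testBit v := fun e => by
        simp [e] at h'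
      simp [Instr.step, this, h1]
    · intro h'
      apply Reach.instr
      rw [h12, h13] at h h'
      have : (firstLegal H).testBit u = (firstLegal H).testBit v := by
        cases h1 : (firstLegal H).testBit u <;> cases h2 : (firstLegal H).testBit v <;>
          simp_all
      simp [Instr.step, this]

/-- Find the first legal coloring, and compare the colors of the vertex and of the reference
vertex. -/
def bruteForce (k : ℕ) : Prog k :=
  .seq (checkColoring k) (.seq (.loop 5 6 (.seq (increment k) (checkColoring k))) (output k))

/-- A bound for the running time of `bruteForce`. -/
def bruteTime (k n : ℕ) : ℕ :=
  (checkTime k n k + 1) + ((2 ^ n * (((4 * n + 4) + (checkTime k n k + 1)) + 1) + 1) + 7)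

theorem reach_bruteForce {H : KGraph k n} {W : ℕ} {ω : ℕ → Fin n} {u v : Fin n}
    (hk : 0 < k) (hH : H.TwoColorable) (hv : (v : ℕ) = n - 1)
    {s : State} (hE : Env k n u W 0 s.mem) :
    Reach H W ω (bruteForce k) s (bruteTime k n) fun s' => s'.mem 0 = canonColoring H v u := by
  obtain ⟨hlegal, hlt⟩ := firstLegal_spec hH
  refine Reach.seq ((reach_checkColoring hk hE).mono le_rfl ?_)
  rintro s₁ hs₁
  refine Reach.seq (((Reach.loop (firstLegal H) (fun j s' => j ≤ firstLegal H ∧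
    Env k n u W j s'.mem ∧ (s'.mem 6 ≠ 0 ↔ ¬ H.IsLegalColoring (bitColoring n j)))
    ?_ ?_ ⟨by omega, hs₁⟩).mono (Nat.add_le_add_right (Nat.mul_le_mul_right _ hlt.le) _) ?_))
  · rintro j s₂ hj ⟨-, hE₂, h6⟩
    refine ⟨?_, Reach.seq ((reach_increment (by omega) hE₂).mono le_rfl ?_)⟩
    · rw [hE₂.zero, Nat.pos_iff_ne_zero, h6]
      exact not_legal_of_lt_firstLegal hj
    · intro s₃ hE₃
      exact (reach_checkColoring hk hE₃).mono le_rfl fun s₄ h => ⟨hj, h⟩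
  · rintro s₂ ⟨-, hE₂, h6⟩
    rw [hE₂.zero, Nat.pos_iff_ne_zero, h6]
    exact not_not.2 hlegal
  · rintro s₂ ⟨-, hE₂, -⟩
    exact reach_output hv hE₂

/-! ### Random trials -/

/-- Draw `t` random vertices. -/
def drawSample (k : ℕ) : ℕ → Prog k
  | 0 => .instr .skip
  | t + 1 => .seq (drawSample k t) (.instr (.rand (20 + t)))

theorem reach_drawSample {H : KGraph k n} {W : ℕ} {ω : ℕ → Fin n} {s : State} (t : ℕ) :
    Reach H W ω (drawSample k t) s (t + 1) fun s' =>
      (∀ d, d < 20 ∨ 20 + t ≤ d → s'.mem d = s.mem d) ∧ s'.drawn = s.drawn + t ∧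
      ∀ i < t, s'.mem (20 + i) = ω (s.drawn + i) := by
  induction t with
  | zero => exact Reach.instr (T := 0) ⟨fun _ _ => rfl, rfl, by simp⟩
  | succ t ih =>
    refine Reach.seq (T' := 1) (ih.mono le_rfl ?_)
    rintro s₁ ⟨hm, hd, hr⟩
    apply Reach.instr
    simp only [Instr.step]
    refine ⟨fun d hd => ?_, by omega, fun i hi => ?_⟩
    · rw [Function.update_of_ne (by omega), hm d (by omega)]
    · rcases (Nat.lt_succ_iff.1 hi).eq_or_lt with rfl | hi
      · rw [Function.update_self, hd]
      · rw [Function.update_of_ne (by omega), hr i hi]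

/-- Test whether all tuples in a list are edges. -/
def testAll : List (Fin k → ℕ) → Prog k
  | [] => .instr (.const 9 1)
  | f :: l => .seq (testAll l) (.seq (.instr (.query 10 f))
      (.ite 10 3 (.instr (.const 9 0)) (.instr .skip)))

theorem reach_testAll {H : KGraph k n} {W : ℕ} {ω : ℕ → Fin n} {s : State} (hW : 1 < W)
    (h3 : s.mem 3 = 1) (l : List (Fin k → ℕ)) (hl : ∀ f ∈ l, ∀ i, f i ≠ 9 ∧ f i ≠ 10) :
    Reach H W ω (testAll l) s (3 * l.length + 1) fun s' =>
      (∀ d, d ≠ 9 ∧ d ≠ 10 → s'.mem d = s.mem d) ∧ s'.drawn = s.drawn ∧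
      (s'.mem 9 ≠ 0 ↔ ∀ f ∈ l, H.IsEdgeTuple fun i => s.mem (f i)) := by
  classical
  induction l with
  | nil =>
    refine Reach.instr (T := 0) ⟨fun d hd => ?_, rfl, ?_⟩
    · simp only [Instr.step]
      rw [Function.update_of_ne (by omega)]
    · simp [Instr.step, Nat.mod_eq_of_lt hW]
  | cons f l ih =>
    refine Reach.mono (Reach.seq (T' := 3) ((ih fun f hf => hl f (by simp [hf])).mono le_rfl ?_))
      (by simp only [List.length_cons]; omega) fun _ h => h
    rintro s₁ ⟨hm, hd, h9⟩
    apply Reach.instr_seq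
    have hf : (fun i => s₁.mem (f i)) = fun i => s.mem (f i) :=
      funext fun i => hm _ (hl f (by simp) i)
    apply Reach.ite
    · intro h
      apply Reach.instr
      simp only [Instr.step, hf] at h ⊢
      rw [Function.update_self, Function.update_of_ne (by omega), hm 3 (by omega), h3] at h
      have hne : ¬ H.IsEdgeTuple fun i => s.mem (f i) := fun he => by simp [he] at h
      refine ⟨fun d hd => ?_, hd, ?_⟩
      · rw [Function.update_of_ne (by omega), Function.update_of_ne (by omega), hm d hd]
      · simp [hne]
    · intro h
      apply Reach.instr
      simp only [Instr.step, hf] at h ⊢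
      rw [Function.update_self, Function.update_of_ne (by omega), hm 3 (by omega), h3] at h
      have hne : H.IsEdgeTuple fun i => s.mem (f i) := by
        by_contra he
        simp [he] at h
      refine ⟨fun d hd => ?_, hd, ?_⟩
      · rw [Function.update_of_ne (by omega), hm d hd]
      · rw [Function.update_of_ne (by omega), h9]
        simp [hne]

/-- The queries that test `Same`. -/
noncomputable def sameQueries (k : ℕ) : List (Fin k → ℕ) :=
  queries k 0 (half k) ++ queries k 2 (half k)

/-- The queries that test `Diff`. -/
noncomputable def diffQueries (k : ℕ) : List (Fin k → ℕ) :=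
  queries k 0 (half k) ++ queries k 2 (half k)ᶜ

/-- Report the outcome `v` and leave the main loop. -/
def found (k v : ℕ) : Prog k := .seq (.instr (.const 15 v)) (.instr (.const 8 0))

/-- Draw a sample and test whether it determines the color of the vertex. -/
noncomputable def trial (k : ℕ) : Prog k :=
  .seq (drawSample k (2 * (k - 1))) (.seq (testAll (sameQueries k)) (.ite 5 9 (found k 1)
    (.seq (testAll (diffQueries k)) (.ite 5 9 (found k 2) (.instr (.add 7 7 3))))))

/-- A bound for the running time of `trial`. -/
noncomputable def trialTime (k : ℕ) : ℕ :=
  (2 * (k - 1) + 1) + ((3 * (sameQueries k).length + 1) +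
    (((3 * (diffQueries k).length + 1) + 3) + 1))

/-- The sample drawn by a trial that starts after `d` draws. -/
def sampleAt (k : ℕ) (ω : ℕ → Fin n) (d : ℕ) (i : Fin (2 * (k - 1))) : Fin n := ω (d + i)

/-- A failed trial consumes exactly `2 * (k - 1)` draws, so successive trials read disjoint blocks
of `ω`; this is what makes them independent. A successful trial ends the main loop by setting its
limit, cell `8`, to `0`. -/
theorem reach_trial {H : KGraph k n} {W : ℕ} {ω : ℕ → Fin n} {u v : Fin n}
    (hv : (v : ℕ) = n - 1) {s : State} (hE : Env k n u W 0 s.mem) (h7 : s.mem 7 + 1 < W)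
    (h15 : s.mem 15 = 0) :
    Reach H W ω (trial k) s (trialTime k) fun s' => Env k n u W 0 s'.mem ∧
      ((Same H (sampleAt k ω s.drawn) u v ∧ s'.mem 15 = 1 ∧ s'.mem 8 = 0) ∨
       (Diff H (sampleAt k ω s.drawn) u v ∧ s'.mem 15 = 2 ∧ s'.mem 8 = 0) ∨
       (¬ Decides H (sampleAt k ω s.drawn) u v ∧ s'.mem 15 = 0 ∧ s'.mem 8 = s.mem 8 ∧
        s'.mem 7 = s.mem 7 + 1 ∧ s'.drawn = s.drawn + 2 * (k - 1))) := by
  have harr : 20 + 2 * (k - 1) ≤ arr k := by unfold arr; omega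
  have hW := hE.space
  have h1 : 1 % W = 1 := Nat.mod_eq_of_lt (by omega)
  have h2 : 2 % W = 2 := Nat.mod_eq_of_lt (by omega)
  refine Reach.seq ((reach_drawSample _).mono le_rfl ?_)
  rintro s₁ ⟨hm₁, hd₁, hr₁⟩
  have hE₁ : Env k n u W 0 s₁.mem := hE.congr fun d hd => hm₁ d (by omega)
  have hvals : ∀ m : ℕ → ℕ, (∀ d, d ≠ 9 ∧ d ≠ 10 → m d = s₁.mem d) → m 0 = u ∧ m 2 = v ∧
      ∀ i : Fin (2 * (k - 1)), m (20 + i) = sampleAt k ω s.drawn i := by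
    intro m hm
    refine ⟨by rw [hm _ (by omega), hE₁.vertex], by rw [hm _ (by omega), hE₁.ref, hv],
      fun i => ?_⟩
    rw [hm _ (by omega), hr₁ i i.2, sampleAt]
  refine Reach.seq ((reach_testAll (by omega) hE₁.one _ ?_).mono le_rfl ?_)
  · intro f hf
    rcases List.mem_append.1 hf with hf | hf <;> exact mem_queries_ne (by omega) hf
  rintro s₂ ⟨hm₂, hd₂, h9⟩
  have hE₂ : Env k n u W 0 s₂.mem := hE₁.congr fun d hd => hm₂ d (by omega)
  have hsame : s₂.mem 9 ≠ 0 ↔ Same H (sampleAt k ω s.drawn) u v := by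
    obtain ⟨h0, h2, hr⟩ := hvals s₁.mem fun _ _ => rfl
    rw [h9]
    simp only [sameQueries, List.forall_mem_append]
    rw [forall_queries_iff hr h0, forall_queries_iff hr h2, Same]
  apply Reach.ite
  · intro h
    rw [hE₂.zero, Nat.pos_iff_ne_zero, hsame] at h
    refine Reach.mono (T := 2) ?_ (by omega) fun _ h => h
    apply Reach.instr_seq
    apply Reach.instr
    refine ⟨hE₂.congr fun d hd => ?_, Or.inl ⟨h, ?_, ?_⟩⟩
    · simp only [Instr.step]
      rw [Function.update_of_ne (by omega), Function.update_of_ne (by omega)]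
    · simp [Instr.step, h1]
    · simp [Instr.step]
  · intro h
    rw [hE₂.zero, Nat.pos_iff_ne_zero, hsame] at h
    refine Reach.seq (T := 3 * (diffQueries k).length + 1) (T' := 3)
      ((reach_testAll (by omega) hE₂.one _ ?_).mono le_rfl ?_)
    · intro f hf
      rcases List.mem_append.1 hf with hf | hf <;> exact mem_queries_ne (by omega) hf
    rintro s₃ ⟨hm₃, hd₃, h9'⟩
    have hE₃ : Env k n u W 0 s₃.mem := hE₂.congr fun d hd => hm₃ d (by omega)
    have hdiff : s₃.mem 9 ≠ 0 ↔ Diff H (sampleAt k ω s.drawn) u v := by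
      obtain ⟨h0, h2, hr⟩ := hvals s₂.mem hm₂
      rw [h9']
      simp only [diffQueries, List.forall_mem_append]
      rw [forall_queries_iff hr h0, forall_queries_iff hr h2, Diff]
    apply Reach.ite
    · intro h'
      rw [hE₃.zero, Nat.pos_iff_ne_zero, hdiff] at h'
      apply Reach.instr_seq
      apply Reach.instr
      refine ⟨hE₃.congr fun d hd => ?_, Or.inr (Or.inl ⟨h', ?_, ?_⟩)⟩
      · simp only [Instr.step]
        rw [Function.update_of_ne (by omega), Function.update_of_ne (by omega)]
      · simp [Instr.step, h2]
      · simp [Instr.step]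
    · intro h'
      rw [hE₃.zero, Nat.pos_iff_ne_zero, hdiff] at h'
      have hold : ∀ d, d < 9 ∨ d = 15 → s₃.mem d = s.mem d := fun d hd => by
        rw [hm₃ d (by omega), hm₂ d (by omega), hm₁ d (by omega)]
      refine Reach.mono (T := 1) ?_ (by omega) fun _ h => h
      apply Reach.instr
      refine ⟨hE₃.congr fun d hd => ?_, Or.inr (Or.inr ⟨not_or.2 ⟨h, h'⟩, ?_, ?_, ?_, ?_⟩)⟩
      · simp only [Instr.step]
        rw [Function.update_of_ne (by omega)]
      · simp only [Instr.step]
        rw [Function.update_of_ne (by omega), hold _ (by omega), h15]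
      · simp only [Instr.step]
        rw [Function.update_of_ne (by omega), hold _ (by omega)]
      · simp only [Instr.step, Function.update_self]
        rw [hold _ (by omega), hE₃.one, Nat.mod_eq_of_lt h7]
      · simp only [Instr.step]
        omega

/-! ### The oracle -/

/-- Add `t * n` to cell `8`. -/
def setLimit (k : ℕ) : ℕ → Prog k
  | 0 => .instr .skip
  | t + 1 => .seq (setLimit k t) (.instr (.add 8 8 1))

theorem reach_setLimit {H : KGraph k n} {W : ℕ} {ω : ℕ → Fin n} {s : State} (t : ℕ)
    (hW : t * n < W) (h1 : s.mem 1 = n) (h8 : s.mem 8 = 0) :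
    Reach H W ω (setLimit k t) s (t + 1) fun s' =>
      (∀ d, d ≠ 8 → s'.mem d = s.mem d) ∧ s'.drawn = s.drawn ∧ s'.mem 8 = t * n := by
  induction t with
  | zero => exact Reach.instr (T := 0) ⟨fun _ _ => rfl, rfl, by simpa [Instr.step] using h8⟩
  | succ t ih =>
    rw [add_mul, one_mul] at hW
    refine Reach.seq (T' := 1) ((ih (by omega)).mono le_rfl ?_)
    rintro s₁ ⟨hm, hd, h8'⟩
    apply Reach.instr
    simp only [Instr.step]
    refine ⟨fun d hd => ?_, hd, ?_⟩
    · rw [Function.update_of_ne hd, hm d hd]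
    · rw [Function.update_self, h8', hm 1 (by omega), h1, Nat.mod_eq_of_lt hW, add_mul, one_mul]

/-- The program of the oracle, with at most `K * n` trials. -/
noncomputable def oracleProg (k K : ℕ) : Prog k :=
  .seq (.instr (.const 3 1)) (.seq (.instr (.const 4 (arr k))) (.seq (.instr (.sub 2 1 3))
    (.seq (setLimit k K) (.seq (.loop 7 8 (trial k))
      (.ite 5 15 (.ite 3 15 (.instr (.const 0 1)) (.instr (.const 0 0))) (bruteForce k))))))

/-- The oracle: at most `K * n` random trials, followed by brute force. -/
noncomputable def oracle (k K : ℕ) : Algorithm k where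
  prog := oracleProg k K
  wordExp := arr k + K
  kept _ := 0

/-- Words must hold every address of the coloring array and the trial counter. The chosen exponent
suffices because `(n + 2) ^ a > a` for `a = arr k + K`, with one more factor `n + 2` to spare. -/
theorem lt_wordBound (k K n : ℕ) :
    n + arr k < (oracle k K).wordBound n ∧ K * n + 1 < (oracle k K).wordBound n := by
  unfold Algorithm.wordBound oracle
  have harr : 20 ≤ arr k := by unfold arr; omega
  dsimp only
  have h : arr k + K < (n + 2) ^ (arr k + K) := Nat.lt_pow_self (by omega)
  rw [pow_succ]
  have h' : (arr k + K + 1) * (n + 2) ≤ (n + 2) ^ (arr k + K) * (n + 2) :=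
    Nat.mul_le_mul_right _ h
  constructor <;> nlinarith [Nat.zero_le (arr k * n), Nat.zero_le (K * n)]

theorem reach_prelude {H : KGraph k n} {ω : ℕ → Fin n} {u : Fin n} {K T : ℕ} {m : ℕ → ℕ}
    {Q : State → Prop}
    (h : ∀ s : State, Env k n u ((oracle k K).wordBound n) 0 s.mem → s.mem 7 = 0 →
      s.mem 8 = K * n → s.mem 15 = 0 → s.drawn = 0 →
      Reach H ((oracle k K).wordBound n) ω (.seq (.loop 7 8 (trial k))
      (.ite 5 15 (.ite 3 15 (.instr (.const 0 1)) (.instr (.const 0 0))) (bruteForce k))) s T Q) :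
    Reach H ((oracle k K).wordBound n) ω (oracle k K).prog ⟨(oracle k K).startMem m u, 0⟩
      (T + (K + 4)) Q := by
  obtain ⟨hW, hW'⟩ := lt_wordBound k K n
  have harr : 20 ≤ arr k := by unfold arr; omega
  have hu := u.2
  set W := (oracle k K).wordBound n
  rw [show T + (K + 4) = (K + 1 + T) + 3 by omega]
  iterate 3 apply Reach.instr_seq
  have hm0 : ∀ d, 2 ≤ d → (oracle k K).startMem m u d = 0 := by
    intro d hd
    simp only [Algorithm.startMem]
    rw [if_neg (by omega), if_neg (by omega), if_neg]
    -- No cell is kept, so the previous memory `m` has no influence beyond this point.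
    change ¬ d < 2 + 0
    omega
  have hm1 : (oracle k K).startMem m u 1 = n := by simp [Algorithm.startMem]
  have hm2 : (oracle k K).startMem m u 0 = u := by simp [Algorithm.startMem]
  generalize (oracle k K).startMem m u = m₀ at hm0 hm1 hm2
  have h1 : 1 % W = 1 := Nat.mod_eq_of_lt (by omega)
  have harrW : arr k % W = arr k := Nat.mod_eq_of_lt (by omega)
  set s₁ := (Instr.sub (k := k) 2 1 3).step H W ω ((Instr.const 4 (arr k)).step H W ω
    ((Instr.const 3 1).step H W ω ⟨m₀, 0⟩)) with hs₁
  have hE : Env k n u W 0 s₁.mem := by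
    refine ⟨?_, ?_, ?_, ?_, ?_, ?_, fun i => ?_, hu, hW⟩
    · simp [hs₁, Instr.step, hm2]
    · simp [hs₁, Instr.step, hm1]
    · simp [hs₁, Instr.step, hm1, h1]
    · simp [hs₁, Instr.step, h1]
    · simp [hs₁, Instr.step, harrW]
    · simp [hs₁, Instr.step, hm0]
    · simp only [hs₁, Instr.step]
      rw [Function.update_of_ne (by omega), Function.update_of_ne (by omega),
        Function.update_of_ne (by omega), hm0 _ (by omega)]
      simp
  have hz : ∀ d, 6 ≤ d → s₁.mem d = 0 := fun d hd => by
    simp only [hs₁, Instr.step]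
    rw [Function.update_of_ne (by omega), Function.update_of_ne (by omega),
      Function.update_of_ne (by omega), hm0 _ (by omega)]
  have hd : s₁.drawn = 0 := rfl
  refine Reach.seq ((reach_setLimit K (by omega) hE.size (hz 8 (by omega))).mono le_rfl ?_)
  rintro s₂ ⟨hm, hd', h8⟩
  refine h s₂ (hE.congr fun d hd => hm d (by omega)) ?_ h8 ?_ (hd'.trans hd)
  · rw [hm _ (by omega), hz _ (by omega)]
  · rw [hm _ (by omega), hz _ (by omega)]

/-- The `j`-th trial on the vertices `u` and `v` succeeds. -/
def Succeeds (H : KGraph k n) (ω : ℕ → Fin n) (u v : Fin n) (j : ℕ) : Prop :=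
  Decides H (sampleAt k ω (2 * (k - 1) * j)) u v

theorem reach_oracle_of_succeeds {H : KGraph k n} (hk : 2 ≤ k) (hH : H.TwoColorable)
    {ω : ℕ → Fin n} {u v : Fin n} (hv : (v : ℕ) = n - 1) {K τ : ℕ} {m : ℕ → ℕ} (hτ : τ < K * n)
    (hfail : ∀ i < τ, ¬ Succeeds H ω u v i) (hsucc : Succeeds H ω u v τ) :
    Reach H ((oracle k K).wordBound n) ω (oracle k K).prog ⟨(oracle k K).startMem m u, 0⟩
      ((τ + 1) * (trialTime k + 1) + (K + 8)) fun s => s.mem 0 = canonColoring H v u := by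
  obtain ⟨hW, hW'⟩ := lt_wordBound k K n
  have harr : 20 ≤ arr k := by unfold arr; omega
  refine Reach.mono (reach_prelude (T := ((τ + 1) * (trialTime k + 1) + 1) + 3)
    fun s hE h7 h8 h15 hd => ?_) (by omega) fun _ h => h
  set W := (oracle k K).wordBound n
  have h1 : 1 % W = 1 := Nat.mod_eq_of_lt (by omega)
  -- Up to iteration `τ` all trials have failed and the limit is intact. Iteration `τ + 1` is the
  -- successful trial, whose verdict holds in every legal coloring and hence in `canonColoring H v`.
  refine Reach.seq (((Reach.loop (τ + 1) (fun j s' => Env k n u W 0 s'.mem ∧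
    ((j ≤ τ ∧ s'.mem 7 = j ∧ s'.mem 8 = K * n ∧ s'.mem 15 = 0 ∧ s'.drawn = 2 * (k - 1) * j) ∨
     (j = τ + 1 ∧ s'.mem 8 = 0 ∧ ((s'.mem 15 = 1 ∧ canonColoring H v u = 0) ∨
      (s'.mem 15 = 2 ∧ canonColoring H v u = 1))))) ?_ ?_ ?_).mono le_rfl ?_))
  · rintro j s₁ hj ⟨hE₁, ⟨-, h7, h8, h15, hd⟩ | ⟨h, -⟩⟩
    · refine ⟨by omega, (reach_trial hv hE₁ (by omega) h15).mono le_rfl ?_⟩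
      rw [hd, h7, h8]
      rintro s₂ ⟨hE₂, ⟨h, h15', h8'⟩ | ⟨h, h15', h8'⟩ | ⟨h, h15', h8', h7', hd'⟩⟩
      · have hj' : j = τ := by
          by_contra hne
          exact hfail j (by omega) (Or.inl h)
        refine ⟨hE₂, Or.inr ⟨by omega, h8', Or.inl ⟨h15', ?_⟩⟩⟩
        rw [h.color_eq hk (canonColoring_legal hH v), canonColoring_self]
      · have hj' : j = τ := by
          by_contra hne
          exact hfail j (by omega) (Or.inr h)
        refine ⟨hE₂, Or.inr ⟨by omega, h8', Or.inr ⟨h15', ?_⟩⟩⟩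
        have := h.color_ne hk (canonColoring_legal hH v)
        rw [canonColoring_self] at this
        omega
      · have hj' : j ≠ τ := by
          rintro rfl
          exact h hsucc
        refine ⟨hE₂, Or.inl ⟨by omega, h7', h8', h15', ?_⟩⟩
        rw [hd', mul_add, mul_one]
    · omega
  · rintro s₁ ⟨-, ⟨h, -⟩ | ⟨-, h, -⟩⟩ <;> omega
  · exact ⟨hE, Or.inl ⟨by omega, h7, h8, h15, by rw [hd, mul_zero]⟩⟩
  · rintro s₁ ⟨hE₁, ⟨h, -⟩ | ⟨-, -, h⟩⟩
    · omega
    · apply Reach.ite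
      · intro _
        apply Reach.ite
        · intro hlt
          apply Reach.instr
          rw [hE₁.one] at hlt
          rcases h with ⟨h, -⟩ | ⟨-, h⟩
          · omega
          · simp [Instr.step, h, h1]
        · intro hlt
          apply Reach.instr
          rw [hE₁.one] at hlt
          rcases h with ⟨-, h⟩ | ⟨h, -⟩
          · simp [Instr.step, h]
          · omega
      · intro hlt
        rw [hE₁.zero] at hlt
        omega

theorem reach_oracle_of_fails {H : KGraph k n} (hk : 2 ≤ k) (hH : H.TwoColorable)
    {ω : ℕ → Fin n} {u v : Fin n} (hv : (v : ℕ) = n - 1) {K : ℕ} {m : ℕ → ℕ}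
    (hfail : ∀ i < K * n, ¬ Succeeds H ω u v i) :
    Reach H ((oracle k K).wordBound n) ω (oracle k K).prog ⟨(oracle k K).startMem m u, 0⟩
      (K * n * (trialTime k + 1) + (K + 8) + bruteTime k n)
      fun s => s.mem 0 = canonColoring H v u := by
  obtain ⟨hW, hW'⟩ := lt_wordBound k K n
  refine Reach.mono (reach_prelude (T := (K * n * (trialTime k + 1) + 1) + (bruteTime k n + 1))
    fun s hE h7 h8 h15 hd => ?_) (by omega) fun _ h => h
  set W := (oracle k K).wordBound n
  refine Reach.seq (((Reach.loop (K * n) (fun j s' => j ≤ K * n ∧ Env k n u W 0 s'.mem ∧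
    s'.mem 7 = j ∧ s'.mem 8 = K * n ∧ s'.mem 15 = 0 ∧ s'.drawn = 2 * (k - 1) * j)
     ?_ ?_ ?_).mono le_rfl ?_))
  · rintro j s₁ hj ⟨-, hE₁, h7, h8, h15, hd⟩
    refine ⟨by omega, (reach_trial hv hE₁ (by omega) h15).mono le_rfl ?_⟩
    rw [hd, h7, h8]
    rintro s₂ ⟨hE₂, ⟨h, -⟩ | ⟨h, -⟩ | ⟨h, h15', h8', h7', hd'⟩⟩
    · exact (hfail j hj (Or.inl h)).elim
    · exact (hfail j hj (Or.inr h)).elim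
    · refine ⟨by omega, hE₂, h7', h8', h15', ?_⟩
      rw [hd', mul_add, mul_one]
  · rintro s₁ ⟨-, -, h7, h8, -⟩
    omega
  · exact ⟨by omega, hE, h7, h8, h15, by rw [hd, mul_zero]⟩
  · rintro s₁ ⟨-, hE₁, -, -, h15, -⟩
    apply Reach.ite
    · intro h
      omega
    · intro _
      exact reach_bruteForce (by omega) hH hv hE₁

end ColoringOracle

namespace ColoringOracle

open MeasureTheory ProbabilityTheory

variable {k n : ℕ}

/-! ### Correctness of the oracle -/

theorem exists_reach_oracle {H : KGraph k n} (hk : 2 ≤ k) (hH : H.TwoColorable)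
    (ω : ℕ → Fin n) {u v : Fin n} (hv : (v : ℕ) = n - 1) (K : ℕ) (m : ℕ → ℕ) :
    ∃ T, Reach H ((oracle k K).wordBound n) ω (oracle k K).prog ⟨(oracle k K).startMem m u, 0⟩
      T fun s => s.mem 0 = canonColoring H v u := by
  classical
  by_cases h : ∃ τ, τ < K * n ∧ Succeeds H ω u v τ
  · refine ⟨_, reach_oracle_of_succeeds hk hH hv (Nat.find_spec h).1 (fun i hi hs => ?_)
      (Nat.find_spec h).2⟩
    exact Nat.find_min h hi ⟨hi.trans (Nat.find_spec h).1, hs⟩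
  · push Not at h
    exact ⟨_, reach_oracle_of_fails hk hH hv h⟩

/-- Whatever the random choices, each call returns the value of `canonColoring H v`, which depends
only on `H`; the witness is the same for all calls. -/
theorem isColoringOracle_oracle (hk : 2 ≤ k) (K : ℕ) : (oracle k K).IsColoringOracle := by
  refine ⟨fun n H hH u ω => ?_, ?_⟩
  · have hn : 0 < n := (u 0).pos
    set v : Fin n := ⟨n - 1, by omega⟩ with hv
    have hcall : ∀ (i : ℕ) (m : ℕ → ℕ), ∃ m' : ℕ → ℕ,
        (∃ t, (oracle k K).Call H (ω i) m (u i) m' t) ∧ m' 0 = canonColoring H v (u i) := by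
      intro i m
      obtain ⟨T, s, t, he, -, hs⟩ := exists_reach_oracle hk hH (ω i) (u := u i) (v := v) rfl K m
      exact ⟨s.mem, ⟨t, s.drawn, he⟩, hs⟩
    choose f hf hf' using hcall
    exact ⟨fun i => Nat.rec (fun _ => 0) f i, rfl, fun i => hf i _,
      canonColoring H v, canonColoring_legal hH v, fun i => hf' i _⟩
  · have : (fun n => (((oracle k K).kept n : ℕ) : ℝ) * Real.logb 2 ((oracle k K).wordBound n)) =
        fun _ => 0 := by
      ext n
      simp [oracle]
    rw [this]
    exact Asymptotics.isLittleO_zero _ _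

/-! ### The expected running time -/

theorem callTime_le {A : Algorithm k} {H : KGraph k n} {m : ℕ → ℕ} {u : Fin n} {ω : ℕ → Fin n}
    {T : ℕ} {Q : State → Prop}
    (h : Reach H (A.wordBound n) ω A.prog ⟨A.startMem m u, 0⟩ T Q) :
    A.callTime H m u ω ≤ T := by
  obtain ⟨s, t, he, ht, -⟩ := h
  refine le_trans (b := (t : ℝ≥0∞)) ?_ (by exact_mod_cast ht)
  exact sInf_le ⟨s.mem, t, ⟨s.drawn, he⟩, rfl⟩

/-- The event that the first `j` trials fail. -/
def failSet (H : KGraph k n) (u v : Fin n) (j : ℕ) : Set (ℕ → Fin n) :=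
  {ω | ∀ i < j, ¬ Succeeds H ω u v i}

theorem measurableSet_failSet (H : KGraph k n) (u v : Fin n) (j : ℕ) :
    MeasurableSet (failSet H u v j) := by
  have : failSet H u v j = ⋂ i, ⋂ (_ : i < j),
      (fun ω : ℕ → Fin n => sampleAt k ω (2 * (k - 1) * i)) ⁻¹' {r | ¬ Decides H r u v} := by
    ext ω
    simp [failSet, Succeeds]
  rw [this]
  refine MeasurableSet.iInter fun i => MeasurableSet.iInter fun _ => ?_
  refine measurableSet_preimage ?_ (Set.toFinite _).measurableSet
  exact measurable_pi_lambda _ fun a => measurable_pi_apply _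

open scoped Classical in
/-- The samples that do not determine whether `u` and `v` have the same color. -/
noncomputable def badSamples (H : KGraph k n) (u v : Fin n) : Finset (Fin (2 * (k - 1)) → Fin n) :=
  Finset.univ.filter fun r => ¬ Decides H r u v

theorem uniformOn_univ_singleton (x : Fin n) :
    uniformOn (Set.univ : Set (Fin n)) {x} = (n : ℝ≥0∞)⁻¹ := by
  rw [uniformOn_univ, Measure.count_singleton, Fintype.card_fin, one_div]

instance isProbabilityMeasure_uniformOn_univ [NeZero n] :
    IsProbabilityMeasure (uniformOn (Set.univ : Set (Fin n))) :=
  isProbabilityMeasure_uniformOn Set.finite_univ Set.univ_nonempty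

instance isProbabilityMeasure_coins [NeZero n] : IsProbabilityMeasure (Algorithm.coins n) := by
  unfold Algorithm.coins
  infer_instance

theorem coins_cylinder [NeZero n] (I : Finset ℕ) (x : ℕ → Fin n) :
    Algorithm.coins n {ω | ∀ t ∈ I, ω t = x t} = ((n : ℝ≥0∞)⁻¹) ^ I.card := by
  have : {ω : ℕ → Fin n | ∀ t ∈ I, ω t = x t} = Set.pi (I : Set ℕ) fun t => {x t} := by
    ext ω
    simp [Set.mem_pi]
  rw [this, Algorithm.coins, Measure.infinitePi_pi _ fun _ _ => measurableSet_singleton _]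
  simp only [uniformOn_univ_singleton, Finset.prod_const]

/-- Independence is used only through cylinders: failure of the first `j` trials means that the
first `2(k-1)j` draws spell out one of the `j`-tuples of bad samples, and all these cylinders have
the same measure. -/
theorem coins_failSet_le [NeZero n] (H : KGraph k n) (u v : Fin n) (j : ℕ) :
    Algorithm.coins n (failSet H u v j) ≤
      (((badSamples H u v).card : ℝ≥0∞) * ((n : ℝ≥0∞)⁻¹) ^ (2 * (k - 1))) ^ j := by
  classical
  set m := 2 * (k - 1) with hm
  -- Draw number `t` is coordinate `t % m` of the sample in trial `t / m`; the value `0` elsewhere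
  -- is never used.
  let x : (Fin j → badSamples H u v) → ℕ → Fin n := fun σ t =>
    if h : t / m < j ∧ t % m < m then (σ ⟨t / m, h.1⟩).1 ⟨t % m, h.2⟩ else 0
  have hsub : failSet H u v j ⊆ ⋃ σ ∈ (Finset.univ : Finset (Fin j → badSamples H u v)),
      {ω | ∀ t ∈ Finset.range (m * j), ω t = x σ t} := by
    intro ω hω
    simp only [Set.mem_iUnion]
    refine ⟨fun i => ⟨sampleAt k ω (m * i), ?_⟩, Finset.mem_univ _, ?_⟩
    · simp only [badSamples, Finset.mem_filter, Finset.mem_univ, true_and]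
      exact hω i i.2
    · intro t ht
      rw [Finset.mem_range] at ht
      have hm0 : 0 < m := Nat.pos_of_ne_zero (by rintro h0; simp [h0] at ht)
      have h1 : t / m < j := Nat.div_lt_of_lt_mul ht
      have h2 : t % m < m := Nat.mod_lt _ hm0
      simp only [x, h1, h2, and_self, dif_pos, sampleAt, Nat.div_add_mod]
  calc Algorithm.coins n (failSet H u v j)
      ≤ Algorithm.coins n (⋃ σ ∈ (Finset.univ : Finset (Fin j → badSamples H u v)),
          {ω | ∀ t ∈ Finset.range (m * j), ω t = x σ t}) := measure_mono hsub
    _ ≤ ∑ σ : Fin j → badSamples H u v,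
          Algorithm.coins n {ω | ∀ t ∈ Finset.range (m * j), ω t = x σ t} :=
        measure_biUnion_finset_le _ _
    _ = _ := by
        simp only [coins_cylinder, Finset.card_range, Finset.sum_const, Finset.card_univ,
          Fintype.card_fun, Fintype.card_coe, Fintype.card_fin, nsmul_eq_mul, Nat.cast_pow]
        rw [mul_pow, pow_mul _ m j]

/-- A bound for the running time per trial. -/
noncomputable def roundTime (k K : ℕ) : ℕ := trialTime k + K + 9

-- The sum of indicators counts the initial failed trials, so `1` plus it bounds the trials
-- performed up to a constant factor. The last term charges the exhaustive search to the event that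
-- all `K * n` trials fail.
open scoped Classical in
theorem callTime_oracle_le {H : KGraph k n} (hk : 2 ≤ k) (hH : H.TwoColorable)
    (ω : ℕ → Fin n) {u v : Fin n} (hv : (v : ℕ) = n - 1) (K : ℕ) (m : ℕ → ℕ) :
    (oracle k K).callTime H m u ω ≤
      roundTime k K * (1 + ∑ j ∈ Finset.range (K * n), (failSet H u v (j + 1)).indicator 1 ω) +
        bruteTime k n * (failSet H u v (K * n)).indicator 1 ω := by
  by_cases h : ∃ τ, τ < K * n ∧ Succeeds H ω u v τ
  · obtain ⟨hτ, hs⟩ := Nat.find_spec h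
    set τ := Nat.find h
    have hfail : ∀ i < τ, ¬ Succeeds H ω u v i := fun i hi hs =>
      Nat.find_min h hi ⟨hi.trans hτ, hs⟩
    refine (callTime_le (reach_oracle_of_succeeds hk hH hv hτ hfail hs)).trans ?_
    refine le_trans ?_ le_self_add
    have h1 : (τ : ℝ≥0∞) ≤
        ∑ j ∈ Finset.range (K * n), (failSet H u v (j + 1)).indicator 1 ω := by
      calc (τ : ℝ≥0∞) = ∑ j ∈ Finset.range τ, (failSet H u v (j + 1)).indicator 1 ω := by
            rw [Finset.sum_congr rfl (g := fun _ => 1)]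
            · simp
            · intro j hj
              rw [Finset.mem_range] at hj
              exact Set.indicator_of_mem (show ω ∈ failSet H u v (j + 1) from
                fun i hi => hfail i (by omega)) _
        _ ≤ _ := Finset.sum_le_sum_of_subset (Finset.range_subset_range.2 hτ.le)
    calc (((τ + 1) * (trialTime k + 1) + (K + 8) : ℕ) : ℝ≥0∞)
        ≤ ((roundTime k K * (1 + τ) : ℕ) : ℝ≥0∞) := by
          norm_cast
          unfold roundTime
          nlinarith [Nat.zero_le (τ * (K + 8))]
      _ ≤ _ := by
          push_cast
          gcongr
  · push Not at h
    refine (callTime_le (reach_oracle_of_fails hk hH hv h)).trans ?_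
    have h1 : ∑ j ∈ Finset.range (K * n), (failSet H u v (j + 1)).indicator 1 ω =
        ((K * n : ℕ) : ℝ≥0∞) := by
      rw [Finset.sum_congr rfl (g := fun _ => 1)]
      · simp
      · intro j hj
        rw [Finset.mem_range] at hj
        exact Set.indicator_of_mem (show ω ∈ failSet H u v (j + 1) from
          fun i hi => h i (by omega)) _
    rw [h1, Set.indicator_of_mem (show ω ∈ failSet H u v (K * n) from h), Pi.one_apply, mul_one]
    norm_cast
    unfold roundTime
    nlinarith [Nat.zero_le (K * n * (K + 8))]

theorem expectedTime_oracle_le {H : KGraph k n} (hk : 2 ≤ k) (hH : H.TwoColorable)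
    {u v : Fin n} (hv : (v : ℕ) = n - 1) (K : ℕ) {q : ℝ≥0∞}
    (hq : ((badSamples H u v).card : ℝ≥0∞) ≤ q * (n : ℝ≥0∞) ^ (2 * (k - 1))) :
    (oracle k K).expectedTime H u ≤
      roundTime k K * (∑ j ∈ Finset.range (K * n + 1), q ^ j) + bruteTime k n * q ^ (K * n) := by
  have hn : NeZero n := ⟨u.pos.ne'⟩
  have hfail : ∀ j, Algorithm.coins n (failSet H u v j) ≤ q ^ j := by
    intro j
    refine (coins_failSet_le H u v j).trans (pow_le_pow_left' ?_ j)
    calc _ ≤ q * (n : ℝ≥0∞) ^ (2 * (k - 1)) * ((n : ℝ≥0∞)⁻¹) ^ (2 * (k - 1)) := by gcongr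
      _ = q := by
        rw [mul_assoc, ← mul_pow, ENNReal.mul_inv_cancel (by simpa using hn.ne) (by simp), one_pow,
          mul_one]
  refine iSup_le fun m => ?_
  refine (lintegral_mono fun ω => callTime_oracle_le hk hH ω hv K m).trans ?_
  have hmeas : ∀ j, Measurable ((failSet H u v j).indicator (1 : (ℕ → Fin n) → ℝ≥0∞)) := fun j =>
    measurable_one.indicator (measurableSet_failSet H u v j)
  have hsum : Measurable fun ω => (1 : ℝ≥0∞) + ∑ j ∈ Finset.range (K * n),
      (failSet H u v (j + 1)).indicator 1 ω :=
    measurable_const.add (Finset.measurable_sum _ fun j _ => hmeas _)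
  rw [lintegral_add_right _ ((hmeas _).const_mul _), lintegral_const_mul _ (hmeas _),
    lintegral_const_mul _ hsum, lintegral_add_left measurable_const, lintegral_finsetSum _ fun j _ => hmeas _]
  simp only [lintegral_indicator_one (measurableSet_failSet H u v _), lintegral_const, measure_univ,
    mul_one]
  -- The constant `1` for the unconditional first trial becomes the term `q ^ 0`, which explains the
  -- range `K * n + 1`.
  rw [Finset.sum_range_succ', pow_zero, add_comm (Finset.sum _ _)]
  gcongr with j hj
  · exact hfail _
  · exact hfail _

theorem expectedTime_oracle_le_of_lt_one {H : KGraph k n} (hk : 2 ≤ k) (hH : H.TwoColorable)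
    {u v : Fin n} (hv : (v : ℕ) = n - 1) (K : ℕ) {q : ℝ≥0∞}
    (hq : ((badSamples H u v).card : ℝ≥0∞) ≤ q * (n : ℝ≥0∞) ^ (2 * (k - 1))) :
    (oracle k K).expectedTime H u ≤
      roundTime k K * (1 - q)⁻¹ + bruteTime k n * q ^ (K * n) := by
  refine (expectedTime_oracle_le hk hH hv K hq).trans ?_
  gcongr
  rw [← ENNReal.tsum_geometric]
  exact ENNReal.sum_le_tsum _

theorem expectedTime_oracle_le_worst {H : KGraph k n} (hk : 2 ≤ k) (hH : H.TwoColorable)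
    (u : Fin n) (K : ℕ) :
    (oracle k K).expectedTime H u ≤
      ((roundTime k K * (K * n + 1) + bruteTime k n : ℕ) : ℝ≥0∞) := by
  have hn := u.pos
  -- With `q = 1` the hypothesis on bad samples is vacuous, and the bound becomes the time of `K *
  -- n` failed trials followed by the search.
  refine (expectedTime_oracle_le hk hH (v := ⟨n - 1, by omega⟩) rfl K (q := 1) ?_).trans_eq ?_
  · rw [one_mul]
    have := Finset.card_le_univ (badSamples H u ⟨n - 1, by omega⟩)
    rw [Fintype.card_fun, Fintype.card_fin, Fintype.card_fin] at this
    exact_mod_cast this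
  · simp

/-! ### Random subsets rarely contain few of many disjoint small sets -/

section Chernoff

variable {α ι : Type*} [DecidableEq α]

theorem card_filter_subset_powerset {F U : Finset α} (h : F ⊆ U) :
    ((U.powerset.filter fun T => F ⊆ T).card : ℝ) = 2 ^ U.card * (2⁻¹) ^ F.card := by
  have : U.powerset.filter (fun T => F ⊆ T) = Finset.Icc F U := by
    ext T
    simp [and_comm]
  rw [this, Finset.card_Icc_finset h]
  have hle := Finset.card_le_card h
  push_cast
  rw [pow_sub₀ _ (by norm_num) hle, inv_pow]

/-- For uniform `T ⊆ U` the events `E j ⊆ T` are independent, as the sets are disjoint, so the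
expectation factorizes into `1 - 2⁻¹ ^ (|E j| + 1)`. The proof expands the product over subfamilies
`I`, for which the union `I.biUnion E` has the sum of the sizes. -/
theorem sum_powerset_prod_le {U : Finset α} {J : Finset ι} {E : ι → Finset α} {M : ℕ}
    (hU : ∀ j ∈ J, E j ⊆ U) (hM : ∀ j ∈ J, (E j).card ≤ M)
    (hd : (J : Set ι).PairwiseDisjoint E) :
    ∑ T ∈ U.powerset, ∏ j ∈ J, (if E j ⊆ T then (2⁻¹ : ℝ) else 1) ≤
      2 ^ U.card * (1 - 2⁻¹ ^ (M + 1)) ^ J.card := by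
  have h1 : ∀ T : Finset α, ∏ j ∈ J, (if E j ⊆ T then (2⁻¹ : ℝ) else 1) =
      ∑ I ∈ J.powerset, (-2⁻¹) ^ I.card * (if I.biUnion E ⊆ T then (1 : ℝ) else 0) := by
    intro T
    have : ∀ j, (if E j ⊆ T then (2⁻¹ : ℝ) else 1) =
        1 + (-2⁻¹) * (if E j ⊆ T then (1 : ℝ) else 0) := by
      intro j
      split_ifs <;> norm_num
    simp only [this]
    rw [Finset.prod_one_add]
    refine Finset.sum_congr rfl fun I _ => ?_
    rw [Finset.prod_mul_distrib, Finset.prod_const, Finset.prod_ite_zero]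
    simp
  have h2 : ∀ I ∈ J.powerset, ∑ T ∈ U.powerset, (if I.biUnion E ⊆ T then (1 : ℝ) else 0) =
      2 ^ U.card * ∏ j ∈ I, (2⁻¹ : ℝ) ^ (E j).card := by
    intro I hI
    rw [Finset.mem_powerset] at hI
    rw [← Finset.sum_filter, Finset.sum_const, nsmul_eq_mul, mul_one,
      card_filter_subset_powerset (Finset.biUnion_subset.2 fun j hj => hU j (hI hj)),
      Finset.card_biUnion fun i hi j hj hij => hd (hI hi) (hI hj) hij, Finset.prod_pow_eq_pow_sum]
  calc ∑ T ∈ U.powerset, ∏ j ∈ J, (if E j ⊆ T then (2⁻¹ : ℝ) else 1)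
      = ∑ I ∈ J.powerset, (-2⁻¹) ^ I.card *
          ∑ T ∈ U.powerset, (if I.biUnion E ⊆ T then (1 : ℝ) else 0) := by
        simp only [h1, Finset.mul_sum]
        exact Finset.sum_comm
    _ = 2 ^ U.card * ∏ j ∈ J, (1 + -2⁻¹ * (2⁻¹ : ℝ) ^ (E j).card) := by
        rw [Finset.prod_one_add, Finset.mul_sum]
        refine Finset.sum_congr rfl fun I hI => ?_
        rw [h2 I hI, Finset.prod_mul_distrib, Finset.prod_const]
        ring
    _ ≤ 2 ^ U.card * (1 - 2⁻¹ ^ (M + 1)) ^ J.card := by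
        refine mul_le_mul_of_nonneg_left
          ((Finset.prod_le_prod ?_ ?_).trans_eq (Finset.prod_const _)) (by positivity)
        · intro j hj
          have : (2⁻¹ : ℝ) ^ (E j).card ≤ 1 := pow_le_one₀ (by norm_num) (by norm_num)
          linarith
        · intro j hj
          have : (2⁻¹ : ℝ) ^ M ≤ 2⁻¹ ^ (E j).card :=
            pow_le_pow_of_le_one (by norm_num) (by norm_num) (hM j hj)
          rw [pow_succ]
          linarith

/-- This is `1 - p ≤ exp (-p) ≤ 2 ^ (-p)`, raised to the power `q`. -/
theorem one_sub_pow_le_half_pow {p : ℝ} (hp0 : 0 ≤ p) (hp1 : p ≤ 1) {c q : ℕ}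
    (h : (c : ℝ) ≤ p * q) : (1 - p) ^ q ≤ (2⁻¹ : ℝ) ^ c := by
  have h1 : 1 - p ≤ Real.exp (-(p * Real.log 2)) := by
    have := Real.add_one_le_exp (-(p * Real.log 2))
    have h2 : Real.log 2 ≤ 1 := by linarith [Real.log_two_lt_d9]
    nlinarith
  calc (1 - p) ^ q ≤ Real.exp (-(p * Real.log 2)) ^ q := by
        gcongr
    _ = Real.exp (-(p * q * Real.log 2)) := by
        rw [← Real.exp_nat_mul]
        ring_nf
    _ ≤ Real.exp (-(c * Real.log 2)) := by
        have : 0 ≤ Real.log 2 := Real.log_nonneg (by norm_num)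
        gcongr
    _ = (2⁻¹ : ℝ) ^ c := by
        rw [Real.exp_neg, Real.exp_nat_mul, Real.exp_log (by norm_num), inv_pow]

/-- Markov's inequality for the random variable `2 ^ (-N)`, where `N` counts the `E j` inside `T`.
With `p = 2⁻¹ ^ (M + 2)` its mean is at most `(1 - 2p) ^ |J|`, while `N < p |J|` makes it at least
`(1 - p) ^ |J|`. -/
theorem card_filter_few_le {U : Finset α} {J : Finset ι} {E : ι → Finset α} {M : ℕ}
    (hU : ∀ j ∈ J, E j ⊆ U) (hM : ∀ j ∈ J, (E j).card ≤ M)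
    (hd : (J : Set ι).PairwiseDisjoint E) :
    ((U.powerset.filter fun T =>
      ((J.filter fun j => E j ⊆ T).card : ℝ) < 2⁻¹ ^ (M + 2) * J.card).card : ℝ) ≤
      2 ^ U.card * (1 - 2⁻¹ ^ (M + 2)) ^ J.card := by
  set p : ℝ := 2⁻¹ ^ (M + 2) with hp
  have hp0 : 0 < p := by positivity
  have hp1 : p ≤ 2⁻¹ := by
    rw [hp, pow_succ]
    have : (2⁻¹ : ℝ) ^ (M + 1) ≤ 1 := pow_le_one₀ (by norm_num) (by norm_num)
    linarith
  have h2p : (2⁻¹ : ℝ) ^ (M + 1) = 2 * p := by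
    rw [hp, pow_succ _ (M + 1)]
    ring
  set X := U.powerset.filter fun T => ((J.filter fun j => E j ⊆ T).card : ℝ) < p * J.card
  have h1 : (X.card : ℝ) * (1 - p) ^ J.card ≤ 2 ^ U.card * (1 - 2 * p) ^ J.card := by
    rw [← h2p]
    refine le_trans ?_ (sum_powerset_prod_le hU hM hd)
    rw [← nsmul_eq_mul, ← Finset.sum_const]
    calc ∑ _T ∈ X, (1 - p) ^ J.card
        ≤ ∑ T ∈ X, ∏ j ∈ J, (if E j ⊆ T then (2⁻¹ : ℝ) else 1) := by
          refine Finset.sum_le_sum fun T hT => ?_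
          rw [Finset.prod_ite, Finset.prod_const, Finset.prod_const_one, mul_one]
          exact one_sub_pow_le_half_pow hp0.le (by linarith) (Finset.mem_filter.1 hT).2.le
      _ ≤ _ := Finset.sum_le_sum_of_subset_of_nonneg (Finset.filter_subset _ _) fun T _ _ =>
          Finset.prod_nonneg fun j _ => by split_ifs <;> norm_num
  have h3 : (0 : ℝ) < (1 - p) ^ J.card := pow_pos (by linarith) _
  -- Since `1 - 2p ≤ (1 - p) ^ 2`, the quotient of the two bounds is at most `(1 - p) ^ |J|`.
  have h4 : (1 - 2 * p) ^ J.card ≤ (1 - p) ^ J.card * (1 - p) ^ J.card := by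
    rw [← mul_pow]
    exact pow_le_pow_left₀ (by linarith) (by nlinarith) _
  refine le_of_mul_le_mul_right ?_ h3
  calc (X.card : ℝ) * (1 - p) ^ J.card ≤ 2 ^ U.card * (1 - 2 * p) ^ J.card := h1
    _ ≤ 2 ^ U.card * ((1 - p) ^ J.card * (1 - p) ^ J.card) := by gcongr
    _ = _ := by ring

end Chernoff

/-! ### Gadgets in a hypergraph with a planted coloring -/

/-- The `k`-sets that are not monochromatic. -/
def bichromatic (k : ℕ) (c : Fin n → Fin 2) : Finset (Finset (Fin n)) :=
  Finset.univ.filter fun e => e.card = k ∧ ∃ v ∈ e, ∃ w ∈ e, c v ≠ c w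

theorem isLegalColoring_iff_subset {H : KGraph k n} {c : Fin n → Fin 2} :
    H.IsLegalColoring c ↔ H.1 ⊆ bichromatic k c := by
  unfold KGraph.IsLegalColoring bichromatic
  constructor
  · exact fun h e he => by simpa using ⟨H.2 e he, h e he⟩
  · intro h e he
    have := h he
    rw [Finset.mem_filter] at this
    exact this.2.2

/-- The edges required by `Cert`. -/
def certEdges (k : ℕ) {m : ℕ} (r : Fin m → Fin n) (w : Fin n) (Y : Finset (Fin m)) :
    Finset (Finset (Fin n)) :=
  ((Finset.univ : Finset (Finset (Option (Fin m)))).filter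
    fun e => e.card = k ∧ e ≠ Finset.insertNone Y).image fun e => e.image (extend r w)

theorem cert_of_subset {H : KGraph k n} {m : ℕ} {r : Fin m → Fin n} {w : Fin n}
    {Y : Finset (Fin m)} (h : certEdges k r w Y ⊆ H.1) : Cert H r w Y := by
  intro e he hne
  exact h (Finset.mem_image_of_mem _ (by simp [he, hne]))

theorem card_certEdges_le {m : ℕ} (r : Fin m → Fin n) (w : Fin n) (Y : Finset (Fin m)) :
    (certEdges k r w Y).card ≤ 2 ^ (m + 1) := by
  refine Finset.card_image_le.trans ((Finset.card_le_univ _).trans_eq ?_)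
  simp

/-- Converse of the forcing lemma. A monochromatic `k`-set containing `w` lies in `{w} ∪ Y` and, by
size, is the excluded set; one avoiding `w` lies in `Y` or in its complement, each of which is too
small. -/
theorem certEdges_subset_bichromatic {m : ℕ} {r : Fin m → Fin n} {w : Fin n}
    {Y : Finset (Fin m)} {c : Fin n → Fin 2} (hinj : Function.Injective (extend r w))
    (hY' : Yᶜ.card < k) (hYk : Y.card + 1 = k)
    (hc : ∀ i, c (r i) = c w ↔ i ∈ Y) : certEdges k r w Y ⊆ bichromatic k c := by
  intro E hE
  simp only [certEdges, Finset.mem_image, Finset.mem_filter, Finset.mem_univ, true_and] at hE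
  obtain ⟨e, ⟨he, hne⟩, rfl⟩ := hE
  simp only [bichromatic, Finset.mem_filter, Finset.mem_univ, true_and]
  refine ⟨by rw [Finset.card_image_of_injective _ hinj, he], ?_⟩
  by_contra! hmono
  have hm : ∀ x ∈ e, ∀ y ∈ e, c (extend r w x) = c (extend r w y) := fun x hx y hy =>
    hmono _ (Finset.mem_image_of_mem _ hx) _ (Finset.mem_image_of_mem _ hy)
  have hle : ∀ S : Finset (Fin m), e ⊆ S.map Function.Embedding.some → k ≤ S.card := by
    intro S hS
    have := Finset.card_le_card hS
    rwa [he, Finset.card_map] at this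
  by_cases hnone : none ∈ e
  · apply hne
    refine Finset.eq_of_subset_of_card_le (fun x hx => ?_) (by simp [he, hYk])
    cases x with
    | none => simp
    | some i =>
      rw [Finset.some_mem_insertNone, ← hc]
      exact hm _ hx _ hnone
  · by_cases hex : ∃ i ∈ Y, some i ∈ e
    · obtain ⟨i, hi, hie⟩ := hex
      refine absurd (hle Y fun x hx => ?_) (by omega)
      cases x with
      | none => exact absurd hx hnone
      | some i' =>
        refine Finset.mem_map_of_mem _ ((hc i').1 ?_)
        rw [← (hc i).2 hi]
        exact hm _ hx _ hie
    · refine absurd (hle Yᶜ fun x hx => ?_) (by omega)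
      cases x with
      | none => exact absurd hx hnone
      | some i' =>
        refine Finset.mem_map_of_mem _ ?_
        rw [Finset.mem_compl]
        exact fun hi' => hex ⟨i', hi', hx⟩

/-- The positions of the sample points that should have the same color as `w`, if those in
`half k` have the same color as `u`. -/
def side (k : ℕ) (c : Fin n → Fin 2) (u w : Fin n) : Finset (Fin (2 * (k - 1))) :=
  if c w = c u then half k else (half k)ᶜ

theorem card_half_compl (k : ℕ) : (half k)ᶜ.card = k - 1 := by
  rw [Finset.card_compl, card_half, Fintype.card_fin]
  omega

/-- The edges of the gadget that determines the relative color of `u` and `v`. -/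
def gadget (k : ℕ) (c : Fin n → Fin 2) (u v : Fin n) (r : Fin (2 * (k - 1)) → Fin n) :
    Finset (Finset (Fin n)) :=
  certEdges k r u (side k c u u) ∪ certEdges k r v (side k c u v)

theorem decides_of_gadget_subset {H : KGraph k n} {c : Fin n → Fin 2} {u v : Fin n}
    {r : Fin (2 * (k - 1)) → Fin n} (h : gadget k c u v r ⊆ H.1) : Decides H r u v := by
  obtain ⟨h1, h2⟩ := Finset.union_subset_iff.1 h
  simp only [side, if_true] at h1
  by_cases hc : c v = c u
  · simp only [side, hc, if_true] at h2
    exact Or.inl ⟨cert_of_subset h1, cert_of_subset h2⟩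
  · simp only [side, hc, if_false] at h2
    exact Or.inr ⟨cert_of_subset h1, cert_of_subset h2⟩

/-- The size bound for gadgets. -/
def gadgetSize (k : ℕ) : ℕ := 2 ^ (2 * (k - 1) + 1) + 2 ^ (2 * (k - 1) + 1)

theorem card_gadget_le (c : Fin n → Fin 2) (u v : Fin n) (r : Fin (2 * (k - 1)) → Fin n) :
    (gadget k c u v r).card ≤ gadgetSize k :=
  (Finset.card_union_le _ _).trans (add_le_add (card_certEdges_le _ _ _) (card_certEdges_le _ _ _))

/-- A lower bound for the probability that a gadget is present. -/
noncomputable def gadgetProb (k : ℕ) : ℝ := 2⁻¹ ^ (gadgetSize k + 2)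

theorem gadgetProb_pos (k : ℕ) : 0 < gadgetProb k := by
  unfold gadgetProb
  positivity

theorem gadgetProb_le (k : ℕ) : gadgetProb k ≤ 2⁻¹ := by
  unfold gadgetProb
  exact pow_le_of_le_one (by norm_num) (by norm_num) (by omega)

/-- Disjoint groups of `P` vertices, one for each position of a sample, with the colors that
a gadget for the vertices `u` and `v` needs. -/
structure Groups (k P : ℕ) (c : Fin n → Fin 2) (u v : Fin n) where
  point : Fin (2 * (k - 1)) → ZMod P → Fin n
  inj : ∀ i a i' a', point i a = point i' a' → i = i' ∧ a = a'
  ne_left : ∀ i a, point i a ≠ u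
  ne_right : ∀ i a, point i a ≠ v
  color : ∀ i a, c (point i a) = c u ↔ i ∈ half k

namespace Groups

variable {P : ℕ} {c : Fin n → Fin 2} {u v : Fin n} (g : Groups k P c u v)

/-- The sample with the `τ i`-th point of the `i`-th group. -/
def sample (τ : Fin (2 * (k - 1)) → ZMod P) (i : Fin (2 * (k - 1))) : Fin n := g.point i (τ i)

include g in
theorem color_side (w : Fin n) (i : Fin (2 * (k - 1))) (a : ZMod P) :
    c (g.point i a) = c w ↔ i ∈ side k c u w := by
  have := g.color i a
  unfold side
  split_ifs with h
  · rw [h, this]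
  · rw [Finset.mem_compl, ← this]
    omega

theorem gadget_subset (hk : 0 < k) (τ : Fin (2 * (k - 1)) → ZMod P) :
    gadget k c u v (g.sample τ) ⊆ bichromatic k c := by
  have hinj : ∀ w, (∀ i a, g.point i a ≠ w) → Function.Injective (extend (g.sample τ) w) := by
    intro w hw x y hxy
    cases x <;> cases y
    · rfl
    · exact absurd hxy.symm (hw _ _)
    · exact absurd hxy (hw _ _)
    · exact congrArg some (g.inj _ _ _ _ hxy).1
  have hcard : ∀ w, (side k c u w).card = k - 1 ∧ (side k c u w)ᶜ.card = k - 1 := by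
    intro w
    unfold side
    split_ifs
    · exact ⟨card_half k, card_half_compl k⟩
    · exact ⟨card_half_compl k, by rw [compl_compl, card_half]⟩
  refine Finset.union_subset ?_ ?_
  · refine certEdges_subset_bichromatic (hinj u g.ne_left) ?_ ?_ fun i => g.color_side u i _ <;>
    have := hcard u <;> omega
  · refine certEdges_subset_bichromatic (hinj v g.ne_right) ?_ ?_ fun i => g.color_side v i _ <;>
    have := hcard v <;> omega

/-- An edge of a gadget contains at most one point outside the sample, hence at least `k - 1 ≥ 2`
sample points; this is where `k ≥ 3` matters. The groups are disjoint and avoid `u` and `v`, so each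
sample point reveals its position and index. -/
theorem exists_common {τ τ' : Fin (2 * (k - 1)) → ZMod P} (hk : 3 ≤ k)
    (h : ¬ Disjoint (gadget k c u v (g.sample τ)) (gadget k c u v (g.sample τ'))) :
    ∃ i i', i ≠ i' ∧ τ i = τ' i ∧ τ i' = τ' i' := by
  rw [Finset.not_disjoint_iff] at h
  obtain ⟨E, hE, hE'⟩ := h
  have key : ∀ τ, E ∈ gadget k c u v (g.sample τ) → ∃ w, (w = u ∨ w = v) ∧
      ∃ e : Finset (Option (Fin (2 * (k - 1)))), e.card = k ∧
        e.image (extend (g.sample τ) w) = E := by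
    intro τ hE
    rcases Finset.mem_union.1 hE with h | h <;>
    simp only [certEdges, Finset.mem_image, Finset.mem_filter, Finset.mem_univ, true_and] at h
    · obtain ⟨e, ⟨h1, -⟩, h2⟩ := h
      exact ⟨u, Or.inl rfl, e, h1, h2⟩
    · obtain ⟨e, ⟨h1, -⟩, h2⟩ := h
      exact ⟨v, Or.inr rfl, e, h1, h2⟩
  obtain ⟨w, -, e, he, heE⟩ := key τ hE
  obtain ⟨w', hw', e', -, heE'⟩ := key τ' hE'
  have hcard : 1 < (Finset.eraseNone e).card := by
    have h1 : e ⊆ Finset.insertNone (Finset.eraseNone e) := by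
      rw [Finset.insertNone_eraseNone]
      exact Finset.subset_insert _ _
    have h2 := Finset.card_le_card h1
    rw [Finset.card_insertNone] at h2
    omega
  have hagree : ∀ i ∈ Finset.eraseNone e, τ i = τ' i := by
    intro i hi
    rw [Finset.mem_eraseNone] at hi
    have : extend (g.sample τ) w (some i) ∈ E := heE ▸ Finset.mem_image_of_mem _ hi
    rw [← heE', Finset.mem_image] at this
    obtain ⟨x, -, hx⟩ := this
    cases x with
    | none =>
      rcases hw' with rfl | rfl
      · exact absurd hx.symm (g.ne_left _ _)
      · exact absurd hx.symm (g.ne_right _ _)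
    | some i' =>
      obtain ⟨rfl, h⟩ := g.inj _ _ _ _ hx
      exact h.symm
  obtain ⟨i, hi, i', hi', hne⟩ := Finset.one_lt_card.1 hcard
  exact ⟨i, i', hne, hagree i hi, hagree i' hi'⟩

/-- A line in the plane over `ZMod P`, as the function `i ↦ a i + b`. -/
def line {m : ℕ} (ab : ZMod P × ZMod P) (i : Fin m) : ZMod P := ab.1 * (i : ℕ) + ab.2

/-- Two points determine a line over the field `ZMod P`; `m ≤ P` keeps distinct positions distinct
modulo `P`. -/
theorem line_eq_of_common {m : ℕ} (hP : P.Prime) (hm : m ≤ P) {ab ab' : ZMod P × ZMod P}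
    {i i' : Fin m} (hne : i ≠ i') (h : line ab i = line ab' i) (h' : line ab i' = line ab' i') :
    ab = ab' := by
  have := Fact.mk hP
  unfold line at h h'
  have hi : ((i : ℕ) : ZMod P) - ((i' : ℕ) : ZMod P) ≠ 0 := by
    rw [sub_ne_zero, Ne, ZMod.natCast_eq_natCast_iff, Nat.ModEq, Nat.mod_eq_of_lt (by omega),
      Nat.mod_eq_of_lt (by omega)]
    omega
  have h1 : ab.1 = ab'.1 := by
    rw [← sub_eq_zero]
    refine (mul_eq_zero.1 ?_).resolve_right hi
    linear_combination h - h'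
  refine Prod.ext h1 ?_
  rw [h1] at h
  linear_combination h

/-- For each translate `θ` the `P ^ 2` gadgets on `θ + line` are pairwise disjoint, so the Chernoff
bound applies. If no translate is bad, averaging over the `P ^ (2(k-1))` translates shows that
enough samples have their gadget. -/
theorem card_few_gadgets_le (hk : 3 ≤ k) (hP : P.Prime) (hmP : 2 * (k - 1) ≤ P) [NeZero P] :
    (((bichromatic k c).powerset.filter fun T =>
      ((Finset.univ.filter fun τ : Fin (2 * (k - 1)) → ZMod P =>
        gadget k c u v (g.sample τ) ⊆ T).card : ℝ) <
          gadgetProb k * P ^ (2 * (k - 1))).card : ℝ) ≤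
      P ^ (2 * (k - 1)) * (2 ^ (bichromatic k c).card *
        (1 - gadgetProb k) ^ (P ^ 2)) := by
  set p : ℝ := gadgetProb k with hp
  set m := 2 * (k - 1) with hm
  let E : (Fin m → ZMod P) → ZMod P × ZMod P → Finset (Finset (Fin n)) := fun θ ab =>
    gadget k c u v (g.sample (θ + line ab))
  let bad : (Fin m → ZMod P) → Finset (Finset (Finset (Fin n))) := fun θ =>
    (bichromatic k c).powerset.filter fun T =>
      ((Finset.univ.filter fun ab => E θ ab ⊆ T).card : ℝ) <
        p * (Finset.univ : Finset (ZMod P × ZMod P)).card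
  have hcardJ : (Finset.univ : Finset (ZMod P × ZMod P)).card = P ^ 2 := by
    rw [Finset.card_univ, Fintype.card_prod, ZMod.card, sq]
  have hcardθ : (Finset.univ : Finset (Fin m → ZMod P)).card = P ^ m := by
    rw [Finset.card_univ, Fintype.card_fun, ZMod.card, Fintype.card_fin]
  have hbad : ∀ θ, ((bad θ).card : ℝ) ≤ 2 ^ (bichromatic k c).card * (1 - p) ^ (P ^ 2) := by
    intro θ
    rw [← hcardJ]
    refine card_filter_few_le (fun ab _ => g.gadget_subset (by omega) _)
      (fun ab _ => card_gadget_le _ _ _ _) ?_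
    intro ab _ ab' _ hne
    by_contra hnd
    obtain ⟨i, i', hii, h1, h2⟩ := g.exists_common hk hnd
    simp only [Pi.add_apply, add_right_inj] at h1 h2
    exact hne (line_eq_of_common hP hmP hii h1 h2)
  have hsub : (bichromatic k c).powerset.filter (fun T =>
      ((Finset.univ.filter fun τ : Fin m → ZMod P =>
        gadget k c u v (g.sample τ) ⊆ T).card : ℝ) < p * P ^ m) ⊆ Finset.univ.biUnion bad := by
    intro T hT
    rw [Finset.mem_filter] at hT
    obtain ⟨hTU, hT⟩ := hT
    by_contra hnot
    simp only [Finset.mem_biUnion, Finset.mem_univ, true_and, bad, Finset.mem_filter, hTU,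
      not_exists, not_lt, hcardJ] at hnot
    -- For a fixed line, `θ ↦ θ + line` is a bijection, so each sample `τ` is counted once per line,
    -- that is, `P ^ 2` times.
    have hdouble : ∑ θ : Fin m → ZMod P, (Finset.univ.filter fun ab => E θ ab ⊆ T).card =
        P ^ 2 * (Finset.univ.filter fun τ : Fin m → ZMod P =>
          gadget k c u v (g.sample τ) ⊆ T).card := by
      simp only [Finset.card_filter]
      rw [Finset.sum_comm, ← hcardJ, ← smul_eq_mul, ← Finset.sum_const]
      refine Finset.sum_congr rfl fun ab _ => ?_
      exact Equiv.sum_comp (Equiv.addRight (line ab)) fun τ : Fin m → ZMod P =>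
        if gadget k c u v (g.sample τ) ⊆ T then 1 else 0
    have hsum := Finset.sum_le_sum fun (θ : Fin m → ZMod P) (_ : θ ∈ Finset.univ) => hnot θ
    rw [Finset.sum_const, hcardθ, nsmul_eq_mul, ← Nat.cast_sum, hdouble] at hsum
    push_cast at hsum
    have hP0 : (0 : ℝ) < (P : ℝ) ^ 2 := pow_pos (by exact_mod_cast hP.pos) 2
    nlinarith
  calc _ ≤ (((Finset.univ : Finset (Fin m → ZMod P)).biUnion bad).card : ℝ) := by
        exact_mod_cast Finset.card_le_card hsub
    _ ≤ ∑ θ : Fin m → ZMod P, ((bad θ).card : ℝ) := by exact_mod_cast Finset.card_biUnion_le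
    _ ≤ ∑ θ : Fin m → ZMod P, 2 ^ (bichromatic k c).card * (1 - p) ^ (P ^ 2) :=
        Finset.sum_le_sum fun θ _ => hbad θ
    _ = _ := by
        rw [Finset.sum_const, hcardθ, nsmul_eq_mul]
        push_cast
        rfl

end Groups

/-! ### Counting hypergraphs -/

/-- Each color must fill `k - 1` groups of `P` points; the additional `2` pays for avoiding `u` and
`v`. -/
theorem nonempty_groups {P : ℕ} [NeZero P] {c : Fin n → Fin 2} (u v : Fin n)
    (hc : ∀ a, (k - 1) * P + 2 ≤ (Finset.univ.filter fun w => c w = a).card) :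
    Nonempty (Groups k P c u v) := by
  have hpick : ∀ (a : Fin 2) (S : Finset (Fin (2 * (k - 1)))), S.card = k - 1 →
      ∃ f : S × ZMod P → Fin n, Function.Injective f ∧ ∀ x, c (f x) = a ∧ f x ≠ u ∧ f x ≠ v := by
    intro a S hS
    set A := ((Finset.univ.filter fun w => c w = a).erase u).erase v with hA
    have hcard : Fintype.card (S × ZMod P) ≤ Fintype.card A := by
      rw [Fintype.card_prod, Fintype.card_coe, Fintype.card_coe, hS, ZMod.card]
      have h1 := Finset.pred_card_le_card_erase (s := Finset.univ.filter fun w => c w = a) (a := u)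
      have h2 : ((Finset.univ.filter fun w => c w = a).erase u).card - 1 ≤ A.card :=
        Finset.pred_card_le_card_erase
      have := hc a
      omega
    obtain ⟨f⟩ := Function.Embedding.nonempty_of_card_le hcard
    refine ⟨fun x => (f x).1, fun x y h => f.injective (Subtype.ext h), fun x => ?_⟩
    have := (f x).2
    simp only [hA, Finset.mem_erase, Finset.mem_filter, Finset.mem_univ, true_and] at this
    exact ⟨this.2.2, this.2.1, this.1⟩
  obtain ⟨f, hf, hf'⟩ := hpick (c u) (half k) (card_half k)
  obtain ⟨f₂, hf₂, hf₂'⟩ := hpick (1 - c u) (half k)ᶜ (card_half_compl k)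
  have hne : (1 : Fin 2) - c u ≠ c u := by
    generalize c u = a
    revert a
    decide
  refine ⟨⟨fun i a => if h : i ∈ half k then f (⟨i, h⟩, a) else
    f₂ (⟨i, Finset.mem_compl.2 h⟩, a), ?_, ?_, ?_, ?_⟩⟩
  · intro i a i' a' h
    by_cases hi : i ∈ half k <;> by_cases hi' : i' ∈ half k <;> simp only [hi, hi', dif_pos,
      dif_neg, not_false_eq_true] at h
    · have := hf h
      simpa using this
    · have h1 := (hf' (⟨i, hi⟩, a)).1
      rw [h, (hf₂' _).1] at h1
      exact absurd h1 hne
    · have h1 := (hf' (⟨i', hi'⟩, a')).1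
      rw [← h, (hf₂' _).1] at h1
      exact absurd h1 hne
    · have := hf₂ h
      simpa using this
  · intro i a
    split_ifs
    · exact (hf' _).2.1
    · exact (hf₂' _).2.1
  · intro i a
    split_ifs
    · exact (hf' _).2.2
    · exact (hf₂' _).2.2
  · intro i a
    split_ifs with h
    · simp [h, (hf' _).1]
    · simp [h, (hf₂' _).1, hne]

open scoped Classical in
theorem card_legal_filter_le (c : Fin n → Fin 2) (p : Finset (Finset (Fin n)) → Prop) :
    (Finset.univ.filter fun H : KGraph k n => H.IsLegalColoring c ∧ p H.1).card ≤
      ((bichromatic k c).powerset.filter p).card := by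
  refine Finset.card_le_card_of_injOn Subtype.val ?_ Subtype.val_injective.injOn
  intro H hH
  simp only [Finset.coe_filter, Finset.mem_univ, true_and] at hH
  simp only [Finset.coe_filter, Finset.mem_powerset]
  exact ⟨isLegalColoring_iff_subset.1 hH.1, hH.2⟩

/-- Every set of bichromatic `k`-sets is a 2-colorable hypergraph. This comparison with a single
coloring replaces any estimate of the number of 2-colorable hypergraphs. -/
theorem two_pow_card_bichromatic_le (c : Fin n → Fin 2) :
    2 ^ (bichromatic k c).card ≤ (twoColorableGraphs k n).card := by
  rw [← Finset.card_powerset]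
  refine le_trans (Finset.card_le_card (t := (twoColorableGraphs k n).image Subtype.val) ?_)
    Finset.card_image_le
  intro T hT
  rw [Finset.mem_powerset] at hT
  refine Finset.mem_image.2 ⟨⟨T, fun e he => ?_⟩, ?_, rfl⟩
  · have := hT he
    simp only [bichromatic, Finset.mem_filter] at this
    exact this.2.1
  · simp only [twoColorableGraphs, Finset.mem_filter, Finset.mem_univ, true_and]
    exact ⟨c, isLegalColoring_iff_subset.2 hT⟩

/-- `H` has a vertex `u` such that more than a `1 - η` fraction of the samples do not determine
whether `u` and `v` have the same color. -/
def Atypical (H : KGraph k n) (v : Fin n) (η : ℝ) : Prop :=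
  ∃ u, (1 - η) * (n : ℝ) ^ (2 * (k - 1)) < (badSamples H u v).card

-- For each `u`, distinct transversals are distinct samples, and a sample whose gadget lies in `H`
-- decides. An atypical `H` therefore has too few gadgets for some `u`, which gives the factor `n`.
open scoped Classical in
theorem card_legal_atypical_le {P : ℕ} {c : Fin n → Fin 2} {v : Fin n} {η : ℝ} (hk : 3 ≤ k)
    (hP : P.Prime) (hmP : 2 * (k - 1) ≤ P)
    (hc : ∀ a, (k - 1) * P + 2 ≤ (Finset.univ.filter fun w => c w = a).card)
    (hη : η * (n : ℝ) ^ (2 * (k - 1)) ≤ gadgetProb k * P ^ (2 * (k - 1))) :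
    ((Finset.univ.filter fun H : KGraph k n => H.IsLegalColoring c ∧ Atypical H v η).card : ℝ) ≤
      n * (P ^ (2 * (k - 1)) * (2 ^ (bichromatic k c).card * (1 - gadgetProb k) ^ (P ^ 2))) := by
  have : NeZero P := ⟨hP.ne_zero⟩
  have g : ∀ u, Groups k P c u v := fun u => (nonempty_groups u v hc).some
  let few : Fin n → Finset (Finset (Fin n)) → Prop := fun u T =>
    ((Finset.univ.filter fun τ : Fin (2 * (k - 1)) → ZMod P =>
        gadget k c u v ((g u).sample τ) ⊆ T).card : ℝ) < gadgetProb k * P ^ (2 * (k - 1))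
  have hsub : (Finset.univ.filter fun H : KGraph k n => H.IsLegalColoring c ∧ Atypical H v η) ⊆
      Finset.univ.biUnion fun u : Fin n =>
        Finset.univ.filter fun H : KGraph k n => H.IsLegalColoring c ∧ few u H.1 := by
    intro H hH
    simp only [Finset.mem_filter, Finset.mem_univ, true_and] at hH
    obtain ⟨hl, u, hu⟩ := hH
    simp only [Finset.mem_biUnion, Finset.mem_univ, true_and, Finset.mem_filter]
    refine ⟨u, hl, ?_⟩
    have hsum := Finset.card_filter_add_card_filter_not
      (s := (Finset.univ : Finset (Fin (2 * (k - 1)) → Fin n))) fun r => Decides H r u v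
    rw [Finset.card_univ, Fintype.card_fun, Fintype.card_fin, Fintype.card_fin] at hsum
    have hle : (Finset.univ.filter fun τ : Fin (2 * (k - 1)) → ZMod P =>
        gadget k c u v ((g u).sample τ) ⊆ H.1).card ≤
        (Finset.univ.filter fun r : Fin (2 * (k - 1)) → Fin n => Decides H r u v).card := by
      refine Finset.card_le_card_of_injOn (g u).sample ?_ ?_
      · intro τ hτ
        simp only [Finset.coe_filter, Finset.mem_univ, true_and] at hτ ⊢
        exact decides_of_gadget_subset hτ
      · intro τ _ τ' _ h
        ext i
        rw [((g u).inj i _ i _ (congrFun h i)).2]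
    have hsum' : ((Finset.univ.filter fun r : Fin (2 * (k - 1)) → Fin n =>
        Decides H r u v).card : ℝ) + (badSamples H u v).card = (n : ℝ) ^ (2 * (k - 1)) := by
      exact_mod_cast hsum
    have hle' : ((Finset.univ.filter fun τ : Fin (2 * (k - 1)) → ZMod P =>
        gadget k c u v ((g u).sample τ) ⊆ H.1).card : ℝ) ≤
        (Finset.univ.filter fun r : Fin (2 * (k - 1)) → Fin n => Decides H r u v).card := by
      exact_mod_cast hle
    simp only [few]
    linarith
  calc _ ≤ (((Finset.univ : Finset (Fin n)).biUnion fun u : Fin n =>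
        Finset.univ.filter fun H : KGraph k n => H.IsLegalColoring c ∧ few u H.1).card : ℝ) := by
        exact_mod_cast Finset.card_le_card hsub
    _ ≤ ∑ u : Fin n, ((Finset.univ.filter fun H : KGraph k n =>
          H.IsLegalColoring c ∧ few u H.1).card : ℝ) := by exact_mod_cast Finset.card_biUnion_le
    _ ≤ ∑ u : Fin n,
        (P ^ (2 * (k - 1)) * (2 ^ (bichromatic k c).card * (1 - gadgetProb k) ^ (P ^ 2))) := by
        refine Finset.sum_le_sum fun u _ => ?_
        refine le_trans (Nat.cast_le.2 (card_legal_filter_le c (few u))) ?_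
        refine Eq.trans_le ?_ ((g u).card_few_gadgets_le hk hP hmP)
        congr
    _ = _ := by rw [Finset.sum_const, Finset.card_univ, Fintype.card_fin, nsmul_eq_mul]

/-! ### Unbalanced colorings -/

theorem card_bichromatic_add_le (c : Fin n → Fin 2) (a : Fin 2) :
    (bichromatic k c).card + (Finset.univ.filter fun w => c w = a).card.choose k ≤ n.choose k := by
  rw [← Finset.card_powersetCard, ← Finset.card_union_of_disjoint]
  · have : n.choose k = (Finset.powersetCard k (Finset.univ : Finset (Fin n))).card := by
      rw [Finset.card_powersetCard, Finset.card_univ, Fintype.card_fin]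
    rw [this]
    refine Finset.card_le_card (Finset.union_subset ?_ (Finset.powersetCard_mono
      (Finset.subset_univ _)))
    intro e he
    simp only [bichromatic, Finset.mem_filter] at he
    simp [Finset.mem_powersetCard, he.2.1]
  · rw [Finset.disjoint_left]
    intro e he he'
    simp only [bichromatic, Finset.mem_filter] at he
    obtain ⟨-, -, x, hx, y, hy, hxy⟩ := he
    have hs := (Finset.mem_powersetCard.1 he').1
    have h1 := hs hx
    have h2 := hs hy
    simp only [Finset.mem_filter, Finset.mem_univ, true_and] at h1 h2
    exact hxy (h1.trans h2.symm)

theorem le_card_bichromatic_add (c : Fin n → Fin 2) :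
    n.choose k ≤ (bichromatic k c).card + (Finset.univ.filter fun w => c w = 0).card.choose k +
      (Finset.univ.filter fun w => c w = 1).card.choose k := by
  have : n.choose k = (Finset.powersetCard k (Finset.univ : Finset (Fin n))).card := by
    rw [Finset.card_powersetCard, Finset.card_univ, Fintype.card_fin]
  rw [this, ← Finset.card_powersetCard, ← Finset.card_powersetCard]
  refine le_trans (Finset.card_le_card (t := bichromatic k c ∪
    Finset.powersetCard k (Finset.univ.filter fun w => c w = 0) ∪
    Finset.powersetCard k (Finset.univ.filter fun w => c w = 1)) ?_)
    ((Finset.card_union_le _ _).trans (Nat.add_le_add_right (Finset.card_union_le _ _) _))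
  intro e he
  have hek := (Finset.mem_powersetCard.1 he).2
  simp only [Finset.mem_union, bichromatic, Finset.mem_powersetCard, Finset.mem_filter,
    Finset.mem_univ, true_and, hek, and_true]
  by_contra! h
  obtain ⟨⟨h1, h2⟩, h3⟩ := h
  obtain ⟨x, hx, hx0⟩ := Finset.not_subset.1 h2
  obtain ⟨y, hy, hy0⟩ := Finset.not_subset.1 h3
  have := h1 x hx y hy
  simp only [Finset.mem_filter, Finset.mem_univ, true_and] at hx0 hy0
  omega

/-- Pascal's rule applied `d` times, each step adding at least `h.choose j`. -/
theorem choose_add_mul_le (h d j : ℕ) :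
    h.choose (j + 1) + d * h.choose j ≤ (h + d).choose (j + 1) := by
  induction d with
  | zero => simp
  | succ d ih =>
    rw [← add_assoc, Nat.choose_succ_succ', add_mul, one_mul]
    have := Nat.choose_le_choose j (Nat.le_add_right h d)
    omega

theorem le_choose {h j : ℕ} (h1 : 1 ≤ j) (h2 : j < h) : h ≤ h.choose j := by
  induction h with
  | zero => omega
  | succ h ih =>
    obtain ⟨j, rfl⟩ : ∃ i, j = i + 1 := ⟨j - 1, by omega⟩
    rcases (Nat.lt_succ_iff.1 h2).eq_or_lt with h3 | h3
    · rw [h3, Nat.choose_succ_self_right]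
    · rw [Nat.choose_succ_succ']
      have := ih h3
      have := Nat.choose_pos (n := h) (k := j) (by omega)
      omega

/-- With `h = ⌈n/2⌉`, `d = b - h` and `j = k - 1`, the bounds `5h ≤ 12d` and `3 C(h,k) ≤ h C(h,j)`
turn `C(b,k) ≥ C(h,k) + d C(h,j)` into `12 C(b,k) ≥ 24 C(h,k) + h^2`. The gap is thus at least
`h^2/12 ≥ n^2/48`. -/
theorem choose_gap {b : ℕ} (hk : 3 ≤ k) (hn : 2 * k + 20 ≤ n) (hb : 3 * n ≤ 4 * b) :
    ∃ s, 2 * (n - n / 2).choose k + s ≤ b.choose k ∧ n ^ 2 ≤ 48 * s := by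
  obtain ⟨j, rfl⟩ : ∃ i, k = i + 1 := ⟨k - 1, by omega⟩
  set h := n - n / 2 with hh
  obtain ⟨d, rfl⟩ : ∃ d, b = h + d := ⟨b - h, by omega⟩
  have h1 := choose_add_mul_le h d j
  have h2 := Nat.choose_succ_right_eq h j
  have h3 : h ≤ h.choose j := le_choose (by omega) (by omega)
  have h4 : 5 * h ≤ 12 * d := by omega
  have h5 : 3 * h.choose (j + 1) ≤ h.choose j * h := by
    calc 3 * h.choose (j + 1) ≤ h.choose (j + 1) * (j + 1) := by
          rw [mul_comm]
          exact Nat.mul_le_mul_left _ hk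
      _ = h.choose j * (h - j) := h2
      _ ≤ _ := Nat.mul_le_mul_left _ (Nat.sub_le _ _)
  have h6 : 5 * h * h.choose j ≤ 12 * d * h.choose j := Nat.mul_le_mul_right _ h4
  have h7 : h * h ≤ h * h.choose j := Nat.mul_le_mul_left _ h3
  have h8 : n ^ 2 ≤ 4 * (h * h) := by
    have : n ≤ 2 * h := by omega
    nlinarith
  refine ⟨(h + d).choose (j + 1) - 2 * h.choose (j + 1), ?_, ?_⟩
  · rw [Nat.add_sub_cancel']
    nlinarith
  · have : 24 * h.choose (j + 1) + h * h ≤ 12 * (h + d).choose (j + 1) := by nlinarith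
    omega

/-- The comparison is with the coloring `c₀` by halves, which has at most `2 C(⌈n/2⌉, k)`
monochromatic `k`-sets, whereas the large class of `c` alone has `s` more. -/
theorem two_pow_mul_le_of_unbalanced {c : Fin n → Fin 2} {a : Fin 2} (hk : 3 ≤ k)
    (hn : 2 * k + 20 ≤ n) (ha : 3 * n ≤ 4 * (Finset.univ.filter fun w => c w = a).card) :
    ∃ s, n ^ 2 ≤ 48 * s ∧
      2 ^ (bichromatic k c).card * 2 ^ s ≤ (twoColorableGraphs k n).card := by
  obtain ⟨s, hs, hs'⟩ := choose_gap hk hn ha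
  refine ⟨s, hs', ?_⟩
  let c₀ : Fin n → Fin 2 := fun w => if (w : ℕ) < n / 2 then 0 else 1
  have h0 : (Finset.univ.filter fun w => c₀ w = 0).card = n / 2 := by
    have : (Finset.univ.filter fun w => c₀ w = 0) =
        Finset.univ.filter fun w : Fin n => (w : ℕ) < n / 2 := by
      ext w
      simp [c₀]
    rw [this, Fin.card_filter_val_lt]
    omega
  have h1 : (Finset.univ.filter fun w => c₀ w = 1).card = n - n / 2 := by
    have := Finset.card_filter_add_card_filter_not (s := (Finset.univ : Finset (Fin n)))
      fun w => c₀ w = 0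
    rw [h0, Finset.card_univ, Fintype.card_fin] at this
    have h2 : (Finset.univ.filter fun w => c₀ w = 1) = Finset.univ.filter fun w => ¬ c₀ w = 0 := by
      ext w
      simp only [Finset.mem_filter, Finset.mem_univ, true_and]
      omega
    rw [h2]
    omega
  have h2 := le_card_bichromatic_add (k := k) c₀
  rw [h0, h1] at h2
  have h3 := card_bichromatic_add_le (k := k) c a
  have h4 := Nat.choose_le_choose k (show n / 2 ≤ n - n / 2 by omega)
  rw [← pow_add]
  refine le_trans (Nat.pow_le_pow_right (by norm_num) ?_) (two_pow_card_bichromatic_le c₀)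
  omega

/-! ### Few hypergraphs are atypical -/

theorem one_sub_pow_le_exp {p : ℝ} (hp1 : p ≤ 1) (N : ℕ) :
    (1 - p) ^ N ≤ Real.exp (-(p * N)) := by
  calc (1 - p) ^ N ≤ Real.exp (-p) ^ N := by
        have := Real.add_one_le_exp (-p)
        exact pow_le_pow_left₀ (by linarith) (by linarith) _
    _ = Real.exp (-(p * N)) := by
        rw [← Real.exp_nat_mul]
        ring_nf

theorem fin_two_ne_iff : ∀ a b : Fin 2, ¬ b = a ↔ b = 1 - a := by decide

-- Case distinction on the class sizes of `c`; in both cases an exponent of order `n ^ 2` is gained.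
open scoped Classical in
theorem card_legal_atypical_le_exp (hk : 3 ≤ k) {η κ : ℝ}
    (hη : η = gadgetProb k / (16 * k) ^ (2 * (k - 1)))
    (hκ : κ ≤ gadgetProb k / (16 * k) ^ 2) (hκ' : κ ≤ 1 / 96) (hn : 64 * k ^ 2 ≤ n) (v : Fin n)
    (c : Fin n → Fin 2) :
    ((Finset.univ.filter fun H : KGraph k n => H.IsLegalColoring c ∧ Atypical H v η).card : ℝ) ≤
      (n : ℝ) ^ (2 * (k - 1) + 1) * Real.exp (-(κ * n ^ 2)) * (twoColorableGraphs k n).card := by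
  have hk0 : (0 : ℝ) < 16 * k := by positivity
  have hn64 : 64 * k * k ≤ n := by rw [mul_assoc, ← sq]; exact hn
  have hn192 : 192 * k ≤ n := le_trans (Nat.mul_le_mul_right _ (by omega)) hn64
  have hs0 : n / (16 * k) ≠ 0 := by
    have : 1 ≤ n / (16 * k) := (Nat.one_le_div_iff (by omega)).2 (by omega)
    omega
  -- Bertrand's postulate gives a prime with `n/(16k) < P ≤ n/(8k)`: small enough for the groups to
  -- fit into the classes, large enough that `n ≤ 16kP`, whence the powers of `16k` in `η` and `κ`.
  obtain ⟨P, hP, hsP, hP2⟩ := Nat.exists_prime_lt_and_le_two_mul _ hs0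
  have hPn : 8 * (k * P) ≤ n := by
    calc 8 * (k * P) ≤ 8 * (k * (2 * (n / (16 * k)))) := by gcongr
      _ = 16 * k * (n / (16 * k)) := by ring
      _ ≤ n := Nat.mul_div_le _ _
  have hnP : n ≤ 16 * k * P := by
    have h1 := Nat.lt_mul_of_div_lt hsP (by omega : 0 < 16 * k)
    rw [mul_comm] at h1
    exact h1.le
  have hmP : 2 * (k - 1) ≤ P := by
    have h1 : 64 * k * k ≤ 16 * k * P := hn64.trans hnP
    have h2 : 64 * k * k = 16 * k * (4 * k) := by ring
    rw [h2] at h1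
    have := Nat.le_of_mul_le_mul_left h1 (by omega)
    omega
  have hkP : (k - 1) * P ≤ k * P := Nat.mul_le_mul_right _ (Nat.sub_le _ _)
  have hPn' : P ≤ n := by
    have : P ≤ k * P := Nat.le_mul_of_pos_left _ (by omega)
    omega
  have hnPR : (n : ℝ) ≤ 16 * k * P := by exact_mod_cast hnP
  have hn1 : (1 : ℝ) ≤ n := by exact_mod_cast (show 1 ≤ n by omega)
  have hp := gadgetProb_pos k
  have hp' := gadgetProb_le k
  by_cases hbal : ∀ a, (k - 1) * P + 2 ≤ (Finset.univ.filter fun w => c w = a).card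
  · refine (card_legal_atypical_le hk hP hmP hbal ?_).trans ?_
    · rw [hη, div_mul_eq_mul_div, div_le_iff₀ (by positivity), mul_assoc, ← mul_pow]
      gcongr
      linarith
    · have h1 : (1 - gadgetProb k) ^ (P ^ 2) ≤ Real.exp (-(κ * n ^ 2)) := by
        refine (one_sub_pow_le_exp (by linarith) _).trans (Real.exp_le_exp.2 (neg_le_neg ?_))
        calc κ * n ^ 2 ≤ gadgetProb k / (16 * k) ^ 2 * (16 * k * P) ^ 2 := by gcongr
          _ = gadgetProb k * ((P ^ 2 : ℕ) : ℝ) := by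
            push_cast
            field_simp
      have h2 : (2 : ℝ) ^ (bichromatic k c).card ≤ (twoColorableGraphs k n).card := by
        exact_mod_cast two_pow_card_bichromatic_le c
      calc (n : ℝ) * (P ^ (2 * (k - 1)) * (2 ^ (bichromatic k c).card *
            (1 - gadgetProb k) ^ (P ^ 2)))
          ≤ n * (n ^ (2 * (k - 1)) * ((twoColorableGraphs k n).card *
            Real.exp (-(κ * n ^ 2)))) := by
            have h3 : (0 : ℝ) ≤ 1 - gadgetProb k := by linarith
            gcongr
        _ = _ := by ring
  · push Not at hbal
    -- One class has fewer than `(k-1)P + 2 ≤ n/8 + 2 ≤ n/4` vertices, so the other has at least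
    -- `3n/4`.
    obtain ⟨a, ha⟩ := hbal
    have hsum := Finset.card_filter_add_card_filter_not (s := (Finset.univ : Finset (Fin n)))
      fun w => c w = a
    have hnot : (Finset.univ.filter fun w => ¬ c w = a) =
        Finset.univ.filter fun w => c w = 1 - a := by
      ext w
      simp only [Finset.mem_filter, Finset.mem_univ, true_and]
      exact fin_two_ne_iff _ _
    rw [hnot, Finset.card_univ, Fintype.card_fin] at hsum
    obtain ⟨s, hs, hs'⟩ := two_pow_mul_le_of_unbalanced (c := c) (a := 1 - a) hk
      (by omega) (by omega)
    have hsR : (n : ℝ) ^ 2 ≤ 48 * s := by exact_mod_cast hs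
    have hsR' : (2 : ℝ) ^ (bichromatic k c).card * 2 ^ s ≤ (twoColorableGraphs k n).card := by
      exact_mod_cast hs'
    -- Here `2⁻¹ ^ s ≤ exp (-s/2)` and `s ≥ n^2/48`, which accounts for the bound `1/96` on `κ`.
    have h1 : (2⁻¹ : ℝ) ^ s ≤ Real.exp (-(κ * n ^ 2)) := by
      have := one_sub_pow_le_exp (p := 2⁻¹) (by norm_num) s
      rw [show (1 : ℝ) - 2⁻¹ = 2⁻¹ by norm_num] at this
      refine this.trans (Real.exp_le_exp.2 (neg_le_neg ?_))
      nlinarith [sq_nonneg (n : ℝ)]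
    have h2 : ((Finset.univ.filter fun H : KGraph k n =>
        H.IsLegalColoring c ∧ Atypical H v η).card : ℝ) ≤ 2 ^ (bichromatic k c).card := by
      have h3 : (Finset.univ.filter fun H : KGraph k n =>
          H.IsLegalColoring c ∧ Atypical H v η).card ≤ 2 ^ (bichromatic k c).card := by
        rw [← Finset.card_powerset]
        refine Finset.card_le_card_of_injOn Subtype.val (fun H hH => ?_)
          Subtype.val_injective.injOn
        simp only [Finset.coe_filter, Finset.mem_univ, true_and] at hH
        exact Finset.mem_powerset.2 (isLegalColoring_iff_subset.1 hH.1)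
      exact_mod_cast h3
    calc _ ≤ (2 : ℝ) ^ (bichromatic k c).card := h2
      _ = 1 * 2⁻¹ ^ s * (2 ^ (bichromatic k c).card * 2 ^ s) := by
        rw [inv_pow]
        field_simp
      _ ≤ _ := by
        have h5 : (1 : ℝ) ≤ (n : ℝ) ^ (2 * (k - 1) + 1) := one_le_pow₀ hn1
        gcongr

open scoped Classical in
theorem card_atypical_le (hk : 3 ≤ k) {η κ : ℝ}
    (hη : η = gadgetProb k / (16 * k) ^ (2 * (k - 1)))
    (hκ : κ ≤ gadgetProb k / (16 * k) ^ 2) (hκ' : κ ≤ 1 / 96) (hn : 64 * k ^ 2 ≤ n) (v : Fin n) :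
    (((twoColorableGraphs k n).filter fun H => Atypical H v η).card : ℝ) ≤
      2 ^ n * ((n : ℝ) ^ (2 * (k - 1) + 1) * Real.exp (-(κ * n ^ 2)) *
        (twoColorableGraphs k n).card) := by
  have hsub : ((twoColorableGraphs k n).filter fun H => Atypical H v η) ⊆
      (Finset.univ : Finset (Fin n → Fin 2)).biUnion fun c =>
        Finset.univ.filter fun H : KGraph k n => H.IsLegalColoring c ∧ Atypical H v η := by
    intro H hH
    simp only [twoColorableGraphs, Finset.mem_filter, Finset.mem_univ, true_and] at hH
    obtain ⟨⟨c, hc⟩, hH⟩ := hH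
    simp only [Finset.mem_biUnion, Finset.mem_univ, true_and, Finset.mem_filter]
    exact ⟨c, hc, hH⟩
  calc _ ≤ (((Finset.univ : Finset (Fin n → Fin 2)).biUnion fun c => Finset.univ.filter
        fun H : KGraph k n => H.IsLegalColoring c ∧ Atypical H v η).card : ℝ) := by
        exact_mod_cast Finset.card_le_card hsub
    _ ≤ ∑ c : Fin n → Fin 2, ((Finset.univ.filter
        fun H : KGraph k n => H.IsLegalColoring c ∧ Atypical H v η).card : ℝ) := by
        exact_mod_cast Finset.card_biUnion_le
    _ ≤ ∑ _c : Fin n → Fin 2, (n : ℝ) ^ (2 * (k - 1) + 1) * Real.exp (-(κ * n ^ 2)) *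
          (twoColorableGraphs k n).card :=
        Finset.sum_le_sum fun c _ => card_legal_atypical_le_exp hk hη hκ hκ' hn v c
    _ = _ := by
        rw [Finset.sum_const, Finset.card_univ, Fintype.card_fun, Fintype.card_fin,
          Fintype.card_fin, nsmul_eq_mul]
        push_cast
        rfl

/-! ### Bounds for the worst-case running time -/

theorem checkTime_le (k n j : ℕ) : checkTime k n j ≤ (4 * k + 7 + 2 * j) * (n + 1) ^ j := by
  induction j with
  | zero => simp [checkTime]
  | succ j ih =>
    have h1 : 1 ≤ (n + 1) ^ j := Nat.one_le_pow _ _ (by omega)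
    simp only [checkTime]
    calc n * (checkTime k n j + 1 + 1) + 1 + 1
        ≤ (n + 1) * (checkTime k n j + 1 + 1) := by nlinarith
      _ ≤ (n + 1) * ((4 * k + 7 + 2 * j) * (n + 1) ^ j + 2 * (n + 1) ^ j) :=
        Nat.mul_le_mul_left _ (by linarith)
      _ = _ := by ring

theorem pow_le_factorial_mul_exp (x j : ℕ) : (x : ℝ) ^ j ≤ j.factorial * Real.exp x := by
  have := Real.pow_div_factorial_le_exp (x : ℝ) (by positivity) j
  rwa [div_le_iff₀ (by positivity), mul_comm] at this

theorem two_pow_le_exp (n : ℕ) : (2 : ℝ) ^ n ≤ Real.exp n := by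
  rw [← mul_one (n : ℝ), Real.exp_nat_mul]
  gcongr
  linarith [Real.add_one_le_exp 1]

/-- There are at most `2 ^ n ≤ exp n` colorings, and checking one costs `O((n + 1) ^ k)`, which is
`O(exp n)`. -/
theorem exists_bruteTime_le (hk : 0 < k) :
    ∃ C : ℝ, 0 ≤ C ∧ ∀ n : ℕ, (bruteTime k n : ℝ) ≤ C * Real.exp (2 * n) := by
  set A : ℕ := 4 * k + 7 + 2 * k with hA
  refine ⟨(2 * A + 18 : ℕ) * (k.factorial * Real.exp 1), by positivity, fun n => ?_⟩
  have h1 : bruteTime k n ≤ 2 ^ n * ((2 * A + 18) * (n + 1) ^ k) := by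
    have hT := checkTime_le k n k
    have h2 : 1 ≤ 2 ^ n := Nat.one_le_two_pow
    have h3 : n + 1 ≤ (n + 1) ^ k := Nat.le_self_pow (by omega) _
    unfold bruteTime
    calc _ ≤ 2 ^ n * (2 * checkTime k n k + 18 * (n + 1)) := by nlinarith
      _ ≤ 2 ^ n * (2 * (A * (n + 1) ^ k) + 18 * (n + 1) ^ k) := by gcongr
      _ = _ := by ring
  calc (bruteTime k n : ℝ) ≤ 2 ^ n * ((2 * A + 18 : ℕ) * ((n + 1 : ℕ) : ℝ) ^ k) := by
        exact_mod_cast h1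
    _ ≤ Real.exp n * ((2 * A + 18 : ℕ) * (k.factorial * Real.exp ((n + 1 : ℕ) : ℝ))) := by
        gcongr
        · exact two_pow_le_exp n
        · exact pow_le_factorial_mul_exp _ _
    _ = _ := by
        push_cast
        rw [Real.exp_add, two_mul (n : ℝ), Real.exp_add]
        ring

theorem exists_worstTime_oracle_le (hk : 2 ≤ k) (K : ℕ) :
    ∃ C : ℝ, 0 ≤ C ∧ ∀ (n : ℕ) (H : KGraph k n), H.TwoColorable →
      (oracle k K).worstTime H ≤ ENNReal.ofReal (C * Real.exp (2 * n)) := by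
  obtain ⟨C, hC0, hC⟩ := exists_bruteTime_le (k := k) (by omega)
  refine ⟨roundTime k K * (K + 1) + C, by positivity, fun n H hH => iSup_le fun u => ?_⟩
  refine (expectedTime_oracle_le_worst hk hH u K).trans ?_
  rw [← ENNReal.ofReal_natCast]
  refine ENNReal.ofReal_le_ofReal ?_
  push_cast
  rw [add_mul]
  refine add_le_add ?_ (hC n)
  rw [mul_assoc]
  gcongr
  have h1 : 2 * (n : ℝ) + 1 ≤ Real.exp (2 * n) := Real.add_one_le_exp _
  have hn : (0 : ℝ) ≤ n := by positivity
  have hK : (0 : ℝ) ≤ K := by positivity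
  nlinarith [mul_nonneg hK hn]

theorem exists_worstTime_oracle_le_of_typical (hk : 2 ≤ k) {η : ℝ} (hη0 : 0 < η) (hη1 : η ≤ 1) :
    ∃ (K : ℕ) (C : ℝ), 0 ≤ C ∧ ∀ (n : ℕ) (H : KGraph k n) (v : Fin n), (v : ℕ) = n - 1 →
      H.TwoColorable → ¬ Atypical H v η → (oracle k K).worstTime H ≤ ENNReal.ofReal C := by
  obtain ⟨C, hC0, hC⟩ := exists_bruteTime_le (k := k) (by omega)
  -- With `K ≥ 2/η` all `K * n` trials fail with probability at most `exp (-2n)`, cancelling the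
  -- cost of the search.
  obtain ⟨K, hK⟩ := exists_nat_ge (2 / η)
  refine ⟨K, roundTime k K * η⁻¹ + C, by positivity, fun n H v hv hH htyp => iSup_le fun u => ?_⟩
  have hbad : ((badSamples H u v).card : ℝ≥0∞) ≤
      ENNReal.ofReal (1 - η) * (n : ℝ≥0∞) ^ (2 * (k - 1)) := by
    have h1 : ((badSamples H u v).card : ℝ) ≤ (1 - η) * (n : ℝ) ^ (2 * (k - 1)) := by
      by_contra! hlt
      exact htyp ⟨u, hlt⟩
    rw [← ENNReal.ofReal_natCast n, ← ENNReal.ofReal_pow (by positivity),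
      ← ENNReal.ofReal_mul (by linarith), ← ENNReal.ofReal_natCast]
    exact ENNReal.ofReal_le_ofReal h1
  refine (expectedTime_oracle_le_of_lt_one hk hH hv K hbad).trans ?_
  have h2 : (1 : ℝ≥0∞) - ENNReal.ofReal (1 - η) = ENNReal.ofReal η := by
    rw [← ENNReal.ofReal_one, ← ENNReal.ofReal_sub _ (by linarith)]
    congr 1
    ring
  rw [h2, ← ENNReal.ofReal_inv_of_pos hη0, ← ENNReal.ofReal_natCast (roundTime k K),
    ← ENNReal.ofReal_natCast (bruteTime k n), ← ENNReal.ofReal_pow (by linarith),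
    ← ENNReal.ofReal_mul (by positivity), ← ENNReal.ofReal_mul (by positivity),
    ← ENNReal.ofReal_add (by positivity)
      (mul_nonneg (by positivity) (pow_nonneg (by linarith) _))]
  refine ENNReal.ofReal_le_ofReal (add_le_add_right ?_ _)
  have h3 : (1 - η) ^ (K * n) ≤ Real.exp (-(2 * n)) := by
    refine (one_sub_pow_le_exp hη1 _).trans (Real.exp_le_exp.2 (neg_le_neg ?_))
    rw [div_le_iff₀ hη0] at hK
    push_cast
    have hn : (0 : ℝ) ≤ n := by positivity
    nlinarith
  calc (bruteTime k n : ℝ) * (1 - η) ^ (K * n)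
      ≤ C * Real.exp (2 * n) * Real.exp (-(2 * n)) := by
        have := hC n
        have h4 : (0 : ℝ) ≤ (1 - η) ^ (K * n) := pow_nonneg (by linarith) _
        gcongr
    _ = C := by
        rw [mul_assoc, ← Real.exp_add]
        simp

/-! ### The average running time -/

/-- The factors `2 ^ n` and `n ^ j` cost one `exp n` each and the running time two more; `4n - κ n^2
≤ 4/κ` follows from `(κn - 2)^2 ≥ 0`. -/
theorem rare_mul_worst_le {κ : ℝ} (hκ : 0 < κ) (j n : ℕ) :
    (2 : ℝ) ^ n * ((n : ℝ) ^ j * Real.exp (-(κ * n ^ 2))) * Real.exp (2 * n) ≤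
      j.factorial * Real.exp (4 / κ) := by
  calc (2 : ℝ) ^ n * ((n : ℝ) ^ j * Real.exp (-(κ * n ^ 2))) * Real.exp (2 * n)
      ≤ Real.exp n * (j.factorial * Real.exp n * Real.exp (-(κ * n ^ 2))) * Real.exp (2 * n) := by
        gcongr
        · exact two_pow_le_exp n
        · exact pow_le_factorial_mul_exp _ _
    _ = j.factorial * Real.exp (4 * n - κ * n ^ 2) := by
        rw [show 4 * (n : ℝ) - κ * n ^ 2 = n + n + -(κ * n ^ 2) + 2 * n by ring]
        simp only [Real.exp_add]
        ring
    _ ≤ _ := by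
        gcongr
        rw [le_div_iff₀ hκ]
        nlinarith [sq_nonneg (κ * n - 2)]

theorem averageTime_le {A : Algorithm k} {p : KGraph k n → Prop} {a b δ : ℝ} (ha : 0 ≤ a)
    (hδ : 0 ≤ δ)
    (hgood : ∀ H : KGraph k n, H.TwoColorable → ¬ p H → A.worstTime H ≤ ENNReal.ofReal a)
    (hbad : ∀ H : KGraph k n, H.TwoColorable → A.worstTime H ≤ ENNReal.ofReal b)
    (hp : (Set.ncard {H : KGraph k n | H.TwoColorable ∧ p H} : ℝ) ≤
      δ * (twoColorableGraphs k n).card) :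
    A.averageTime n ≤ ENNReal.ofReal (a + δ * b) := by
  classical
  refine ENNReal.div_le_of_le_mul ?_
  have hset : {H : KGraph k n | H.TwoColorable ∧ p H} =
      ((twoColorableGraphs k n).filter p : Finset (KGraph k n)) := by
    ext H
    simp [twoColorableGraphs]
  rw [hset, Set.ncard_coe_finset] at hp
  have hcol : ∀ H ∈ twoColorableGraphs k n, H.TwoColorable := fun H hH => by
    simpa [twoColorableGraphs] using hH
  -- For `b ≤ 0` all running times vanish; otherwise `b > 0` makes `ENNReal.ofReal` additive below.
  rcases le_or_gt b 0 with hb | hb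
  · have hz : ∀ H ∈ twoColorableGraphs k n, A.worstTime H = 0 := fun H hH => by
      simpa [ENNReal.ofReal_of_nonpos hb] using hbad H (hcol H hH)
    rw [Finset.sum_eq_zero hz]
    exact zero_le
  calc ∑ H ∈ twoColorableGraphs k n, A.worstTime H
      ≤ ∑ H ∈ twoColorableGraphs k n,
          (ENNReal.ofReal a + if p H then ENNReal.ofReal b else 0) := by
        refine Finset.sum_le_sum fun H hH => ?_
        split_ifs with h
        · exact (hbad H (hcol H hH)).trans le_add_self
        · exact (hgood H (hcol H hH) h).trans le_self_add
    _ = (twoColorableGraphs k n).card * ENNReal.ofReal a +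
          ((twoColorableGraphs k n).filter p).card * ENNReal.ofReal b := by
        rw [Finset.sum_add_distrib, Finset.sum_const, nsmul_eq_mul, ← Finset.sum_filter,
          Finset.sum_const, nsmul_eq_mul]
    _ ≤ (twoColorableGraphs k n).card * ENNReal.ofReal a +
          ENNReal.ofReal (δ * (twoColorableGraphs k n).card) * ENNReal.ofReal b := by
        gcongr
        rw [← ENNReal.ofReal_natCast]
        exact ENNReal.ofReal_le_ofReal hp
    _ = _ := by
        rw [ENNReal.ofReal_mul hδ, ENNReal.ofReal_add ha (by positivity), ENNReal.ofReal_mul hδ,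
          ENNReal.ofReal_natCast]
        ring

theorem exists_averageTime_oracle_le (hk : 3 ≤ k) :
    ∃ (K : ℕ) (C : ℝ≥0), ∀ n : ℕ, (oracle k K).averageTime n ≤ C := by
  set η : ℝ := gadgetProb k / (16 * k) ^ (2 * (k - 1)) with hη
  set κ : ℝ := min (gadgetProb k / (16 * k) ^ 2) (1 / 96) with hκ
  have hk1 : (1 : ℝ) ≤ 16 * k := by
    have : (3 : ℝ) ≤ k := by exact_mod_cast hk
    linarith
  have hp := gadgetProb_pos k
  have hη0 : 0 < η := by positivity
  have hη1 : η ≤ 1 := by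
    refine (div_le_self hp.le (one_le_pow₀ hk1)).trans ?_
    linarith [gadgetProb_le k]
  have hκ0 : 0 < κ := lt_min (by positivity) (by norm_num)
  obtain ⟨K, C₁, hC₁, htyp⟩ := exists_worstTime_oracle_le_of_typical (k := k) (by omega) hη0 hη1
  obtain ⟨C₂, hC₂, hall⟩ := exists_worstTime_oracle_le (k := k) (by omega) K
  set C₃ : ℝ := C₁ + (2 * (k - 1) + 1).factorial * Real.exp (4 / κ) * C₂ with hC₃
  set C₄ : ℝ := C₂ * Real.exp (2 * (64 * k ^ 2 : ℕ)) with hC₄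
  refine ⟨K, (max C₃ C₄).toNNReal, fun n => ?_⟩
  change _ ≤ ENNReal.ofReal (max C₃ C₄)
  rcases lt_or_ge n (64 * k ^ 2) with hn | hn
  -- For the finitely many small `n` every hypergraph is treated as exceptional and the worst-case
  -- bound suffices.
  · refine (averageTime_le (p := fun _ => True) (a := 0) (δ := 1) le_rfl zero_le_one
      (fun H _ h => absurd trivial h) (hall n) ?_).trans (ENNReal.ofReal_le_ofReal ?_)
    · rw [one_mul]
      have : {H : KGraph k n | H.TwoColorable ∧ True} =
          ((twoColorableGraphs k n : Finset (KGraph k n)) : Set (KGraph k n)) := by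
        ext H
        simp [twoColorableGraphs]
      rw [this, Set.ncard_coe_finset]
    · refine le_max_of_le_right ?_
      rw [zero_add, one_mul, hC₄]
      gcongr
  · have hn0 : 0 < n := lt_of_lt_of_le (by positivity) hn
    set v : Fin n := ⟨n - 1, by omega⟩
    refine (averageTime_le (p := fun H => Atypical H v η) (a := C₁)
      (δ := 2 ^ n * ((n : ℝ) ^ (2 * (k - 1) + 1) * Real.exp (-(κ * n ^ 2)))) hC₁ (by positivity)
      (fun H hH h => htyp n H v rfl hH h) (hall n) ?_).trans (ENNReal.ofReal_le_ofReal ?_)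
    · classical
      have : {H : KGraph k n | H.TwoColorable ∧ Atypical H v η} =
          ((twoColorableGraphs k n).filter fun H => Atypical H v η : Finset (KGraph k n)) := by
        ext H
        simp [twoColorableGraphs]
      rw [this, Set.ncard_coe_finset, mul_assoc]
      exact card_atypical_le hk hη (min_le_left _ _) (min_le_right _ _) hn v
    · refine le_max_of_le_left ?_
      have := rare_mul_worst_le hκ0 (2 * (k - 1) + 1) n
      rw [hC₃]
      nlinarith

end ColoringOracle

theorem mainTheorem1 (k : ℕ) (hk : 3 ≤ k) :
    ∃ A : ColoringOracle.Algorithm k,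
      A.IsColoringOracle ∧
      (∃ C : ℝ≥0, ∀ n : ℕ, A.averageTime n ≤ C) ∧
      A.Memoryless := by
  obtain ⟨K, C, hC⟩ := ColoringOracle.exists_averageTime_oracle_le hk
  exact ⟨ColoringOracle.oracle k K, ColoringOracle.isColoringOracle_oracle (by omega) K,
    ⟨C, hC⟩, fun _ => rfl⟩
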